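/- Let $S=R\cup B$ be a balanced bichromatic point set of size $2n$ in the Euclidean plane, i.e. $R$ (red) and $B$ (blue) are disjoint sets of $n$ points each; $S$ is in general position if no three of its points are collinear. A set of rays from $S$ consists of one ray $h_p$ with apex $p$ for every $p\in S$; the ray $h_p$ inherits the color of $p$. It is full-crossing if any two of its rays cross, i.e. have exactly one point in common (in particular, their directions are pairwise different). A full-crossing set $H$ of rays from $S$ induces a circular sequence $C(S,H)$ of colors, obtained by reading the colors of the rays at infinity in clockwise order. A configuration of length $2n$ is a circular sequence (taken up to rotation) of $n$ red and $n$ blue elements. A configuration $C$ of length $2n$ is $\chi$-feasible from $S$ if $C=C(S,H)$ for some full-crossing set $H$ of rays from $S$, and it is universal for full-crossing rays if it is $\chi$-feasible from every balanced bichromatic point set of size $2n$ in general position. **Theorem.** Let $2n\ge 20$. There is no configuration of length $2n$ that is universal for full-crossing rays. That is, for every configuration $C$ of length $2n$ there is a balanced bichromatic point set $S=R\cup B$ of size $2n$, in general position, such that $C$ is not $\chi$-feasible from $S$. -/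

import Mathlib

/-! The Euclidean plane is `ℂ`. -/

/-- The two colors. -/
inductive RayColor : Type
  | red : RayColor
  | blue : RayColor
  deriving DecidableEq

/-- A configuration of length `2 * n`: a circular sequence (a list up to rotation) of colors
consisting of `n` red and `n` blue elements. -/
def IsConfiguration (n : ℕ) (C : Cycle RayColor) : Prop :=
  C.toMultiset.count RayColor.red = n ∧ C.toMultiset.count RayColor.blue = n

/-- A balanced bichromatic set of `2 * n` points of the plane. -/
structure BichromaticPointSet (n : ℕ) where
  red : Finset ℂ
  blue : Finset ℂ
  disjoint : Disjoint red blue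
  card_red : red.card = n
  card_blue : blue.card = n

namespace BichromaticPointSet

/-- The set of all points, red and blue. -/
noncomputable def points {n : ℕ} (S : BichromaticPointSet n) : Finset ℂ :=
  S.red ∪ S.blue

/-- The color of a point of `S` (used only for points of `S`). -/
noncomputable def color {n : ℕ} (S : BichromaticPointSet n) (p : ℂ) : RayColor :=
  if p ∈ S.red then RayColor.red else RayColor.blue

/-- General position: no three points of `S` lie on a line. -/
def GeneralPosition {n : ℕ} (S : BichromaticPointSet n) : Prop :=
  ∀ p ∈ S.points, ∀ q ∈ S.points, ∀ r ∈ S.points,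
    p ≠ q → p ≠ r → q ≠ r → ¬ Collinear ℝ ({p, q, r} : Set ℂ)

end BichromaticPointSet

/-- The closed ray with apex `p` and direction vector `v`. -/
def planeRay (p v : ℂ) : Set ℂ :=
  {x : ℂ | ∃ t : ℝ, 0 ≤ t ∧ x = p + (t : ℂ) * v}

/-- Two sets (rays) cross if they have exactly one point in common. -/
def RaysCross (h₁ h₂ : Set ℂ) : Prop :=
  ∃ x : ℂ, h₁ ∩ h₂ = {x}

/-- A set of rays from `S` is given by a direction vector `v p ≠ 0` for every point `p` of `S`;
it consists of the rays `planeRay p (v p)`. It is full-crossing if its rays pairwise cross. -/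
def IsFullCrossing {n : ℕ} (S : BichromaticPointSet n) (v : ℂ → ℂ) : Prop :=
  (∀ p ∈ S.points, v p ≠ 0) ∧
  ∀ p ∈ S.points, ∀ q ∈ S.points, p ≠ q → RaysCross (planeRay p (v p)) (planeRay q (v q))

/-- `C` is the circular sequence of colors that the rays from `S` with directions `v` induce at
infinity, in clockwise order: listing the points by strictly decreasing argument of their
direction vectors and reading off the colors gives `C`, up to rotation. (Rays that pairwise cross
have pairwise different directions, so that their order at infinity is the order of their
directions.) -/
def InducesAtInfinity {n : ℕ} (S : BichromaticPointSet n) (v : ℂ → ℂ) (C : Cycle RayColor) :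
    Prop :=
  ∃ l : List ℂ, l.toFinset = S.points ∧
    l.Pairwise (fun p q => Complex.arg (v q) < Complex.arg (v p)) ∧
    C = ((l.map S.color : List RayColor) : Cycle RayColor)

/-- `C` is `χ`-feasible from `S`: some full-crossing set of rays from `S` induces `C`. -/
def ChiFeasible {n : ℕ} (S : BichromaticPointSet n) (C : Cycle RayColor) : Prop :=
  ∃ v : ℂ → ℂ, IsFullCrossing S v ∧ InducesAtInfinity S v C

/-- `C` is universal for full-crossing rays: it is `χ`-feasible from every balanced bichromatic
set of `2 * n` points in general position. -/
def UniversalForFullCrossing (n : ℕ) (C : Cycle RayColor) : Prop :=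
  ∀ S : BichromaticPointSet n, S.GeneralPosition → ChiFeasible S C

/-! The proof splits on whether `C` contains five consecutive equal colors (`HasRun`), and a
different point set defeats `C` in each case.

With a run, take alternately colored points in convex position, on a parabola. Each ray points to
the convex side of the tangent at its apex or away from it. Inward rays appear at infinity in the
cyclic order of their apices, outward rays in the reverse order (`Inward.dirCyc`, `Outward.dirCyc`),
and two inward apices never alternate with two outward ones (`ParabolaCrossing.not_alternate`). Of
the five apices of a run, three are of one kind, and each of the three gaps between them contains an
apex of the other color. Two of these of the same kind as the run would split it at infinity; two of
the other kind would alternate with it (`alternating_no_run`).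

Without a run, take the hyperbola `x * y = 1`, where the line through the points with ordinates `c`
and `d` has slope `-(d * c)`. The red points have `c` near `1`; the blue ones have small `|m|` and
lie on both branches, at least five on each. The red rays point essentially to one side of the lines
joining them (`slopeForm_sides`), so they have a first and a last direction. A blue ray from the
appropriate branch falls between these two only if its apex determines a narrow cone of slopes
containing both, and the cones of different blue points are disjoint (`blueParams_separated`). Hence
either that whole branch or all blue points but one avoid the red sector, which gives at least five
blue rays with no red ray among them (`exists_cut`), and so a run. -/

/-! ### Sign conditions for crossing rays. -/

/-- The planar cross product (determinant) of two vectors. -/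
def planeCross (u w : ℂ) : ℝ := u.re * w.im - u.im * w.re

theorem planeCross_swap (u w : ℂ) : planeCross w u = -planeCross u w := by
  unfold planeCross; ring

/-- The sign conditions that hold for crossing rays with apices `p`, `q` and directions
`u`, `w`. -/
structure CrossSigns (p q u w : ℂ) : Prop where
  ne : planeCross u w ≠ 0
  pos : 0 < planeCross u w → 0 ≤ planeCross (q - p) u ∧ 0 ≤ planeCross (q - p) w
  neg : planeCross u w < 0 → planeCross (q - p) u ≤ 0 ∧ planeCross (q - p) w ≤ 0

/-- A common point gives `q - p = t * u - s * w` with `t, s ≥ 0`; taking cross products with `w` and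
`u` yields `t` and `s` times `planeCross u w`. -/
theorem RaysCross.crossSigns {p q u w : ℂ} (hpq : p ≠ q) (hu : u ≠ 0) (hw : w ≠ 0)
    (h : RaysCross (planeRay p u) (planeRay q w)) : CrossSigns p q u w := by
  obtain ⟨x, hx⟩ := h
  have hxm : x ∈ planeRay p u ∩ planeRay q w := by rw [hx]; rfl
  have uniq : ∀ y, y ∈ planeRay p u → y ∈ planeRay q w → y = x := by
    intro y h1 h2
    have : y ∈ planeRay p u ∩ planeRay q w := ⟨h1, h2⟩
    rw [hx] at this; exact this
  obtain ⟨⟨t, ht, hxt⟩, ⟨s, hs, hxs⟩⟩ := hxm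
  have hd : q - p = (t : ℂ) * u - (s : ℂ) * w := by linear_combination hxt - hxs
  have e1 : planeCross (q - p) w = t * planeCross u w := by
    rw [hd]; simp [planeCross]; ring
  have e2 : planeCross (q - p) u = s * planeCross u w := by
    rw [hd]; simp [planeCross]; ring
  refine ⟨?_, ?_, ?_⟩
  · intro h0
    obtain ⟨a, ha⟩ : ∃ a : ℝ, w = (a : ℂ) * u := by
      unfold planeCross at h0
      by_cases hre : u.re = 0
      · have him : u.im ≠ 0 := fun h => hu (Complex.ext hre h)
        refine ⟨w.im / u.im, Complex.ext ?_ ?_⟩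
        · have : w.re = 0 := by
            rw [hre] at h0
            have : u.im * w.re = 0 := by linarith
            exact (mul_eq_zero.mp this).resolve_left him
          simp [hre, this]
        · simp; field_simp
      · refine ⟨w.re / u.re, Complex.ext ?_ ?_⟩
        · simp; field_simp
        · simp; field_simp; linarith
    have ha0 : a ≠ 0 := by rintro rfl; simp at ha; exact hw ha
    -- Parallel rays that meet share more than one point: both apices if the directions are
    -- opposite, `x` and `x + u` if they agree.
    rcases lt_or_gt_of_ne ha0 with han | hap
    · have hq : q = p + ((t - s * a : ℝ) : ℂ) * u := by
        push_cast
        rw [ha] at hd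
        linear_combination hd
      have hts : 0 ≤ t - s * a := by nlinarith
      have h1 : p = x := uniq p ⟨0, le_rfl, by simp⟩
        ⟨(t - s * a) / (-a), div_nonneg hts (by linarith), by
          have hac : (a : ℂ) ≠ 0 := by exact_mod_cast ha0
          rw [ha, hq]; push_cast; field_simp; ring⟩
      have h2 : q = x := uniq q ⟨t - s * a, hts, hq⟩ ⟨0, le_rfl, by simp⟩
      exact hpq (h1.trans h2.symm)
    · have : x + u = x := uniq _ ⟨t + 1, by linarith, by rw [hxt]; push_cast; ring⟩
        ⟨s + 1 / a, by positivity, by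
          have hac : (a : ℂ) ≠ 0 := by exact_mod_cast ha0
          rw [hxs, ha]; push_cast; field_simp; ring⟩
      exact hu (by simpa using this)
  · intro h; rw [e1, e2]; exact ⟨mul_nonneg hs h.le, mul_nonneg ht h.le⟩
  · intro h; rw [e1, e2]
    exact ⟨mul_nonpos_of_nonneg_of_nonpos hs h.le, mul_nonpos_of_nonneg_of_nonpos ht h.le⟩

/-! ### Circular order of directions and of their arguments. -/

/-- Three elements of a linear order are in increasing circular order. -/
def CircLT {α : Type*} [LT α] (a b c : α) : Prop := (a < b ∧ b < c) ∨ (b < c ∧ c < a) ∨ (c < a ∧ a < b)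

/-- Three directions are in counterclockwise circular order. -/
def DirCyc (u v w : ℂ) : Prop :=
  (0 < planeCross u v ∧ 0 < planeCross v w) ∨ (0 < planeCross v w ∧ 0 < planeCross w u) ∨
    (0 < planeCross w u ∧ 0 < planeCross u v)

theorem planeCross_eq_sin (u w : ℂ) :
    planeCross u w = ‖u‖ * ‖w‖ * Real.sin (w.arg - u.arg) := by
  have h1 := Complex.norm_mul_cos_arg u
  have h2 := Complex.norm_mul_sin_arg u
  have h3 := Complex.norm_mul_cos_arg w
  have h4 := Complex.norm_mul_sin_arg w
  rw [planeCross, ← h1, ← h2, ← h3, ← h4, Real.sin_sub]; ring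

theorem planeCross_pos_of_arg {u w : ℂ} (hu : u ≠ 0) (hw : w ≠ 0) (h : u.arg < w.arg)
    (h' : w.arg - u.arg < Real.pi) : 0 < planeCross u w := by
  rw [planeCross_eq_sin]
  have := Real.sin_pos_of_pos_of_lt_pi (sub_pos.mpr h) h'
  have := norm_pos_iff.mpr hu
  have := norm_pos_iff.mpr hw
  positivity

theorem planeCross_nonpos_of_arg {u w : ℂ} (h' : Real.pi ≤ w.arg - u.arg) :
    planeCross u w ≤ 0 := by
  rw [planeCross_eq_sin]
  have h1 := Complex.arg_le_pi w
  have h2 := Complex.neg_pi_lt_arg u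
  have h3 : Real.sin (w.arg - u.arg) ≤ 0 := by
    have := Real.sin_nonneg_of_nonneg_of_le_pi (x := w.arg - u.arg - Real.pi)
      (by linarith) (by linarith)
    rw [Real.sin_sub_pi] at this
    linarith
  exact mul_nonpos_of_nonneg_of_nonpos (by positivity) h3

theorem ne_zero_of_planeCross {u w : ℂ} (h : planeCross u w ≠ 0) : u ≠ 0 ∧ w ≠ 0 := by
  constructor <;> rintro rfl <;> simp [planeCross] at h

theorem arg_ne_of_planeCross {u w : ℂ} (h : planeCross u w ≠ 0) : u.arg ≠ w.arg := by
  intro h'; apply h; rw [planeCross_eq_sin, h']; simp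

theorem planeCross_pos_arg {u w : ℂ} (h : 0 < planeCross u w) :
    (u.arg < w.arg ∧ w.arg - u.arg < Real.pi) ∨ Real.pi < u.arg - w.arg := by
  obtain ⟨hu, hw⟩ := ne_zero_of_planeCross h.ne'
  rcases lt_or_gt_of_ne (arg_ne_of_planeCross h.ne') with h1 | h1
  · left
    refine ⟨h1, ?_⟩
    by_contra h2
    have := planeCross_nonpos_of_arg (u := u) (w := w) (by linarith)
    linarith
  · right
    by_contra h2
    rcases (not_lt.mp h2).lt_or_eq with h3 | h3
    · have := planeCross_pos_of_arg hw hu h1 h3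
      rw [planeCross_swap] at this; linarith
    · have h4 := planeCross_eq_sin w u
      rw [h3, Real.sin_pi, planeCross_swap] at h4
      simp at h4; linarith

theorem DirCyc.circLT {u v w : ℂ} (h : DirCyc u v w) : CircLT u.arg v.arg w.arg := by
  have b1 := Complex.arg_le_pi u
  have b2 := Complex.arg_le_pi v
  have b3 := Complex.arg_le_pi w
  have c1 := Complex.neg_pi_lt_arg u
  have c2 := Complex.neg_pi_lt_arg v
  have c3 := Complex.neg_pi_lt_arg w
  unfold CircLT
  rcases h with ⟨h1, h2⟩ | ⟨h1, h2⟩ | ⟨h1, h2⟩ <;>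
  rcases planeCross_pos_arg h1 with ⟨a1, a2⟩ | a1 <;>
  rcases planeCross_pos_arg h2 with ⟨d1, d2⟩ | d1 <;>
  first
  | exact Or.inl ⟨by linarith, by linarith⟩
  | exact Or.inr (Or.inl ⟨by linarith, by linarith⟩)
  | exact Or.inr (Or.inr ⟨by linarith, by linarith⟩)

theorem DirCyc.of_lt {u v w : ℂ} (h1 : planeCross u v ≠ 0) (h2 : planeCross v w ≠ 0)
    (h3 : planeCross w u ≠ 0) (a1 : u.arg < v.arg) (a2 : v.arg < w.arg) : DirCyc u v w := by
  obtain ⟨hu, hv⟩ := ne_zero_of_planeCross h1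
  obtain ⟨_, hw⟩ := ne_zero_of_planeCross h2
  have b3 := Complex.arg_le_pi w
  have c1 := Complex.neg_pi_lt_arg u
  have key : Real.pi ≤ w.arg - u.arg → 0 < planeCross w u := by
    intro h
    have := planeCross_nonpos_of_arg h
    rw [planeCross_swap] at this
    exact lt_of_le_of_ne (by linarith) h3.symm
  by_cases g1 : v.arg - u.arg < Real.pi
  · have p1 := planeCross_pos_of_arg hu hv a1 g1
    by_cases g2 : w.arg - v.arg < Real.pi
    · exact Or.inl ⟨p1, planeCross_pos_of_arg hv hw a2 g2⟩
    · exact Or.inr (Or.inr ⟨key (by linarith), p1⟩)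
  · exact Or.inr (Or.inl ⟨planeCross_pos_of_arg hv hw a2 (by linarith), key (by linarith)⟩)

theorem DirCyc.rotate {u v w : ℂ} (h : DirCyc u v w) : DirCyc v w u := by
  unfold DirCyc at *; tauto

theorem DirCyc.of_circLT {u v w : ℂ} (h1 : planeCross u v ≠ 0) (h2 : planeCross v w ≠ 0)
    (h3 : planeCross w u ≠ 0) (h : CircLT u.arg v.arg w.arg) : DirCyc u v w := by
  rcases h with h | h | h
  · exact DirCyc.of_lt h1 h2 h3 h.1 h.2
  · exact (DirCyc.of_lt h2 h3 h1 h.1 h.2).rotate.rotate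
  · exact (DirCyc.of_lt h3 h1 h2 h.1 h.2).rotate

/-! ### Runs in the circular sequence. -/

/-- A circular sequence of colors has five consecutive equal elements. -/
def HasRun (C : Cycle RayColor) : Prop :=
  ∃ (c : RayColor) (l : List RayColor), C = ((List.replicate 5 c ++ l : List RayColor) : Cycle RayColor)

/-- A form of the run that is independent of the rotation: no two elements of the other color
separate two members of it. -/
theorem HasRun.exists_finset {θ : ℂ → ℝ} {col : ℂ → RayColor} {l : List ℂ}
    (hl : l.Pairwise (fun p q => θ q < θ p))
    (h : HasRun ((l.map col : List RayColor) : Cycle RayColor)) :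
    ∃ (c : RayColor) (F : Finset ℂ), F.card = 5 ∧ (∀ p ∈ F, p ∈ l ∧ col p = c) ∧
      ∀ p ∈ F, ∀ q ∈ F, ∀ x ∈ l, ∀ y ∈ l, col x ≠ c → col y ≠ c →
        CircLT (θ p) (θ x) (θ q) → CircLT (θ q) (θ y) (θ p) → False := by
  obtain ⟨c, l', h⟩ := h
  rw [Cycle.coe_eq_coe] at h
  obtain ⟨k, hk, h⟩ := List.isRotated_iff_mod.mp h
  rw [List.rotate_eq_drop_append_take hk, ← List.map_drop, ← List.map_take, ← List.map_append,
    List.map_eq_append_iff] at h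
  obtain ⟨a, b, hab, ha, -⟩ := h
  have hl2 : l = l.take k ++ l.drop k := (List.take_append_drop k l).symm
  generalize l.take k = s₁ at hab hl2
  generalize l.drop k = s₂ at hab hl2
  have hacol : ∀ p ∈ a, col p = c := by
    intro p hp
    have : col p ∈ a.map col := List.mem_map_of_mem hp
    rw [ha] at this
    exact List.eq_of_mem_replicate this
  have hmem : ∀ p, p ∈ l ↔ p ∈ a ∨ p ∈ b := by
    intro p
    rw [← List.mem_append, ← hab, hl2]
    simp [or_comm]
  have hnd : a.Nodup := by
    have h1 : l.Nodup := hl.imp (fun {p q} h => by rintro rfl; exact lt_irrefl _ h)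
    have h2 : (s₂ ++ s₁).Nodup := by
      rw [List.nodup_append_comm, ← hl2]; exact h1
    rw [hab] at h2
    exact h2.of_append_left
  refine ⟨c, a.toFinset, ?_, ?_, ?_⟩
  · rw [List.toFinset_card_of_nodup hnd]
    simpa using congrArg List.length ha
  · intro p hp
    rw [List.mem_toFinset] at hp
    exact ⟨(hmem p).mpr (Or.inl hp), hacol p hp⟩
  · intro p hp q hq x hx y hy hxc hyc h1 h2
    rw [List.mem_toFinset] at hp hq
    have hxb : x ∈ b := ((hmem x).mp hx).resolve_left fun h => hxc (hacol x h)
    have hyb : y ∈ b := ((hmem y).mp hy).resolve_left fun h => hyc (hacol y h)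
    unfold CircLT at h1 h2
    rw [hl2] at hl
    -- The place where the linear list is cut open lies either inside the run `a` or inside its
    -- complement `b`.
    rcases List.append_eq_append_iff.mp hab with ⟨d, rfl, rfl⟩ | ⟨d, rfl, rfl⟩
    · simp only [List.pairwise_append, List.mem_append] at hl hp hq
      obtain ⟨⟨-, -, h3⟩, -, h4⟩ := hl
      have key : ∀ x ∈ b, ∀ r, r ∈ s₂ ∨ r ∈ d → (∀ y ∈ b, θ r < θ y) ∨ (∀ y ∈ b, θ y < θ r) :=
        fun x _ r hr => hr.elim (fun hr => Or.inl fun y hy => h4 y (Or.inr hy) r hr)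
          fun hr => Or.inr fun y hy => h3 r hr y hy
      rcases key x hxb p hp with hp' | hp' <;> rcases key x hxb q hq with hq' | hq' <;>
      · have := hp' x hxb
        have := hp' y hyb
        have := hq' x hxb
        have := hq' y hyb
        rcases h1 with h1 | h1 | h1 <;> rcases h2 with h2 | h2 | h2 <;>
          linarith [h1.1, h1.2, h2.1, h2.2]
    · simp only [List.pairwise_append, List.mem_append] at hl hxb hyb
      obtain ⟨-, ⟨-, -, h3⟩, h4⟩ := hl
      have key : ∀ x, x ∈ d ∨ x ∈ s₁ → (∀ r ∈ a, θ x < θ r) ∨ (∀ r ∈ a, θ r < θ x) :=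
        fun x hx => hx.elim (fun hx => Or.inl fun r hr => h3 r hr x hx)
          fun hx => Or.inr fun r hr => h4 x hx r (Or.inl hr)
      rcases key x hxb with hx' | hx' <;> rcases key y hyb with hy' | hy' <;>
      · have := hx' p hp
        have := hx' q hq
        have := hy' p hp
        have := hy' q hq
        rcases h1 with h1 | h1 | h1 <;> rcases h2 with h2 | h2 | h2 <;>
          linarith [h1.1, h1.2, h2.1, h2.2]

/-- Since `l` runs clockwise, the hypothesis says that after `r₀` every element of `T` is met before
any further element of a color other than `c`. The maximal block of color `c` just after `r₀`
therefore contains `T`. -/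
theorem HasRun.of_cut {θ : ℂ → ℝ} {col : ℂ → RayColor} {l : List ℂ}
    (hl : l.Pairwise (fun p q => θ q < θ p)) {c : RayColor} {r₀ : ℂ} (hr₀ : r₀ ∈ l)
    (hc : col r₀ ≠ c) {T : Finset ℂ} (hT : 5 ≤ T.card) (hTl : ∀ b ∈ T, b ∈ l ∧ col b = c)
    (h : ∀ r ∈ l, r ≠ r₀ → col r ≠ c → ∀ b ∈ T, CircLT (θ r₀) (θ r) (θ b)) :
    HasRun ((l.map col : List RayColor) : Cycle RayColor) := by
  obtain ⟨s₁, s₂, rfl⟩ := List.append_of_mem hr₀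
  have hpw : (s₂ ++ s₁).Pairwise (fun r b => ¬ CircLT (θ r₀) (θ r) (θ b)) := by
    simp only [List.pairwise_append, List.pairwise_cons, List.mem_cons] at hl ⊢
    obtain ⟨h1, ⟨h2, h3⟩, h4⟩ := hl
    refine ⟨?_, ?_, ?_⟩
    · refine h3.imp_of_mem fun {a b} ha hb hab => ?_
      have := h2 a ha
      have := h2 b hb
      rintro (h | h | h) <;> linarith [h.1, h.2]
    · refine h1.imp_of_mem fun {a b} ha hb hab => ?_
      have := h4 a ha r₀ (Or.inl rfl)
      have := h4 b hb r₀ (Or.inl rfl)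
      rintro (h | h | h) <;> linarith [h.1, h.2]
    · intro a ha b hb
      have := h2 a ha
      have := h4 b hb r₀ (Or.inl rfl)
      rintro (h | h | h) <;> linarith [h.1, h.2]
  have hnd : r₀ ∉ s₂ ++ s₁ := by
    simp only [List.pairwise_append, List.pairwise_cons, List.mem_cons] at hl
    obtain ⟨h1, ⟨h2, h3⟩, h4⟩ := hl
    intro hr
    rcases List.mem_append.mp hr with hr | hr
    · exact lt_irrefl _ (h2 _ hr)
    · exact lt_irrefl _ (h4 _ hr _ (Or.inl rfl))
  have hmem : ∀ p, p ∈ s₁ ++ r₀ :: s₂ ↔ p = r₀ ∨ p ∈ s₂ ++ s₁ := by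
    intro p; simp; tauto
  have hrot : (s₁ ++ r₀ :: s₂) ~r ((s₂ ++ s₁) ++ [r₀]) := by
    have := List.isRotated_append (l := s₁ ++ [r₀]) (l' := s₂)
    simpa using this
  generalize s₂ ++ s₁ = m at *
  have hsplit := (List.takeWhile_append_dropWhile (p := fun x => decide (col x = c)) (l := m))
  set tk := m.takeWhile (fun x => decide (col x = c)) with htk
  set dr := m.dropWhile (fun x => decide (col x = c)) with hdr
  have htkc : ∀ x ∈ tk, col x = c := by
    intro x hx
    simpa using List.mem_takeWhile_imp hx
  have hsub : T ⊆ tk.toFinset := by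
    intro b hb
    obtain ⟨hbl, hbc⟩ := hTl b hb
    have hbm : b ∈ m := ((hmem b).mp hbl).resolve_left (by rintro rfl; exact hc hbc)
    rw [List.mem_toFinset]
    rw [← hsplit] at hbm
    refine (List.mem_append.mp hbm).resolve_right fun hbd => ?_
    have hne : dr ≠ [] := List.ne_nil_of_mem hbd
    have hhd := List.head_dropWhile_not (fun x => decide (col x = c)) hne
    obtain ⟨r, d, hrd⟩ := List.exists_cons_of_ne_nil hne
    have hrc : col r ≠ c := by
      have : (m.dropWhile (fun x => decide (col x = c))).head hne = r := by
        simp [← hdr, hrd]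
      rw [this] at hhd; simpa using hhd
    have hrm : r ∈ m := by rw [← hsplit, hrd]; simp
    rw [← hsplit, hrd, List.pairwise_append, List.pairwise_cons] at hpw
    have hbd' : b ∈ d := by
      rw [hrd] at hbd
      rcases List.mem_cons.mp hbd with rfl | h
      · exact absurd hbc hrc
      · exact h
    exact hpw.2.1.1 b hbd' (h r ((hmem r).mpr (Or.inr hrm)) (by rintro rfl; exact hnd hrm) hrc b hb)
  have hlen : 5 ≤ tk.length :=
    hT.trans ((Finset.card_le_card hsub).trans (List.toFinset_card_le tk))
  have hrep : tk.map col = List.replicate 5 c ++ List.replicate (tk.length - 5) c := by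
    rw [List.replicate_append_replicate, List.eq_replicate_iff]
    refine ⟨by simp; omega, ?_⟩
    intro x hx
    obtain ⟨y, hy, rfl⟩ := List.mem_map.mp hx
    exact htkc y hy
  refine ⟨c, List.replicate (tk.length - 5) c ++ ((dr ++ [r₀]).map col), ?_⟩
  rw [Cycle.coe_eq_coe]
  have := hrot.map col
  rw [← hsplit, List.append_assoc, List.map_append (l₁ := tk), hrep, List.append_assoc] at this
  exact this

/-! ### Full-crossing rays from points of a parabola. -/

/-- Up to a positive factor `a` is a positive combination of `t` and `b`, so a nonzero `v` weakly to
the left of both is strictly to the left of `a`. -/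
theorem planeCross_pos_of_tangent {t a b v : ℂ} (ha : 0 < planeCross t a)
    (hb : 0 < planeCross t b) (hab : 0 < planeCross a b) (hv : v ≠ 0)
    (h1 : 0 ≤ planeCross t v) (h2 : 0 ≤ planeCross b v) : 0 < planeCross a v := by
  have e : planeCross a v * planeCross t b =
      planeCross a b * planeCross t v + planeCross t a * planeCross b v := by
    unfold planeCross; ring
  have h3 : planeCross t v ≠ 0 ∨ planeCross b v ≠ 0 := by
    by_contra! h
    have e1 : v.re * planeCross t b = b.re * 0 - t.re * 0 := by
      nth_rewrite 1 [← h.1]; rw [← h.2]; unfold planeCross; ring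
    have e2 : v.im * planeCross t b = b.im * 0 - t.im * 0 := by
      nth_rewrite 1 [← h.1]; rw [← h.2]; unfold planeCross; ring
    apply hv
    apply Complex.ext
    · simpa [hb.ne'] using e1
    · simpa [hb.ne'] using e2
  have h4 : 0 < planeCross a v * planeCross t b := by
    rw [e]
    rcases h3 with h | h
    · have := mul_pos hab (lt_of_le_of_ne h1 h.symm)
      have := mul_nonneg ha.le h2
      linarith
    · have := mul_pos ha (lt_of_le_of_ne h2 h.symm)
      have := mul_nonneg hab.le h1
      linarith
  exact pos_of_mul_pos_left h4 hb.le

/-- The points of the parabola `y = x ^ 2` with integral abscissa. -/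
def parabolaPoint (i : ℕ) : ℂ := ⟨i, (i : ℝ) ^ 2⟩

/-- The tangent direction of the parabola at `parabolaPoint i`. -/
def parabolaTangent (i : ℕ) : ℂ := ⟨1, 2 * i⟩

theorem parabolaTangent_cross {i j : ℕ} (h : i ≠ j) :
    0 < planeCross (parabolaTangent i) (parabolaPoint j - parabolaPoint i) := by
  have h' : (j : ℝ) - i ≠ 0 := by rw [sub_ne_zero]; exact_mod_cast h.symm
  have : planeCross (parabolaTangent i) (parabolaPoint j - parabolaPoint i)
      = ((j : ℝ) - i) ^ 2 := by
    simp [planeCross, parabolaTangent, parabolaPoint]; ring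
  rw [this]; positivity

theorem parabolaPoint_det (i j k : ℕ) :
    planeCross (parabolaPoint j - parabolaPoint i) (parabolaPoint k - parabolaPoint i)
      = ((j : ℝ) - i) * (k - i) * (k - j) := by
  simp [planeCross, parabolaPoint]; ring

theorem parabolaPoint_ccw {i j k : ℕ} (h : CircLT i j k) :
    0 < planeCross (parabolaPoint j - parabolaPoint i) (parabolaPoint k - parabolaPoint i) := by
  rw [parabolaPoint_det]
  rcases h with ⟨h1, h2⟩ | ⟨h1, h2⟩ | ⟨h1, h2⟩
  · have h1 : (i : ℝ) < j := by exact_mod_cast h1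
    have h2 : (j : ℝ) < k := by exact_mod_cast h2
    exact mul_pos (mul_pos (by linarith) (by linarith)) (by linarith)
  · have h1 : (j : ℝ) < k := by exact_mod_cast h1
    have h2 : (k : ℝ) < i := by exact_mod_cast h2
    exact mul_pos (mul_pos_of_neg_of_neg (by linarith) (by linarith)) (by linarith)
  · have h1 : (k : ℝ) < i := by exact_mod_cast h1
    have h2 : (i : ℝ) < j := by exact_mod_cast h2
    exact mul_pos_of_neg_of_neg (mul_neg_of_pos_of_neg (by linarith) (by linarith)) (by linarith)

theorem CircLT.rotate {α : Type*} [LT α] {a b c : α} (h : CircLT a b c) : CircLT b c a := by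
  unfold CircLT at *; tauto

theorem CircLT.ne {a b c : ℕ} (h : CircLT a b c) : a ≠ b ∧ b ≠ c ∧ c ≠ a := by
  unfold CircLT at h; omega

section Parabola

variable {N : ℕ} {V : ℕ → ℂ}

/-- Directions of full-crossing rays from the first `N` points of the parabola. -/
def ParabolaCrossing (N : ℕ) (V : ℕ → ℂ) : Prop :=
  ∀ i < N, ∀ j < N, i ≠ j → CrossSigns (parabolaPoint i) (parabolaPoint j) (V i) (V j)

/-- The ray from the parabola point `i` points to the convex side. -/
def Inward (V : ℕ → ℂ) (i : ℕ) : Prop := 0 ≤ planeCross (parabolaTangent i) (V i)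

/-- The ray from the parabola point `i` points away from the convex side. -/
def Outward (V : ℕ → ℂ) (i : ℕ) : Prop := planeCross (parabolaTangent i) (V i) ≤ 0

/-- Seen from `q`, the point `r` lies between the tangent and `p`. Hence `V q` is strictly to the
left of `r - q`, and this decides the sign of its crossing with the ray at `r`. -/
theorem Inward.step (hV : ParabolaCrossing N V) {q r p : ℕ} (hq : q < N) (hr : r < N) (hp : p < N)
    (h : CircLT q r p) (hI : Inward V q) (hX : 0 < planeCross (V q) (V p)) :
    0 < planeCross (V q) (V r) := by
  obtain ⟨h1, h2, h3⟩ := h.ne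
  have := planeCross_pos_of_tangent (parabolaTangent_cross h1) (parabolaTangent_cross h3.symm)
    (parabolaPoint_ccw h) (ne_zero_of_planeCross hX.ne').1 hI ((hV q hq p hp h3.symm).pos hX).1
  have hc := hV q hq r hr h1
  rcases lt_or_gt_of_ne hc.ne with h | h
  · linarith [(hc.neg h).1]
  · exact h

theorem Outward.step (hV : ParabolaCrossing N V) {q r p : ℕ} (hq : q < N) (hr : r < N) (hp : p < N)
    (h : CircLT q r p) (hO : Outward V q) (hX : planeCross (V q) (V p) < 0) :
    planeCross (V q) (V r) < 0 := by
  obtain ⟨h1, h2, h3⟩ := h.ne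
  have hneg : ∀ t : ℂ, planeCross t (-V q) = -planeCross t (V q) := by
    intro t; simp [planeCross]; ring
  have h5 := ((hV q hq p hp h3.symm).neg hX).1
  unfold Outward at hO
  have := planeCross_pos_of_tangent (parabolaTangent_cross h1) (parabolaTangent_cross h3.symm)
    (parabolaPoint_ccw h) (neg_ne_zero.mpr (ne_zero_of_planeCross hX.ne).1)
    (by rw [hneg]; linarith) (by rw [hneg]; linarith)
  rw [hneg] at this
  have hc := hV q hq r hr h1
  rcases lt_or_gt_of_ne hc.ne with h | h
  · exact h
  · linarith [(hc.pos h).1]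

/-- The three instances of `Inward.step` forbid any two of the cyclic cross products from being
negative, and two positive ones are exactly `DirCyc`. -/
theorem Inward.dirCyc (hV : ParabolaCrossing N V) {i j k : ℕ} (hi : i < N) (hj : j < N) (hk : k < N)
    (h : CircLT i j k) (h1 : Inward V i) (h2 : Inward V j) (h3 : Inward V k) :
    DirCyc (V i) (V j) (V k) := by
  obtain ⟨g1, g2, g3⟩ := h.ne
  have s1 := h1.step hV hi hj hk h
  have s2 := h2.step hV hj hk hi h.rotate
  have s3 := h3.step hV hk hi hj h.rotate.rotate
  have n1 := (hV i hi j hj g1).ne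
  have n2 := (hV j hj k hk g2).ne
  have n3 := (hV k hk i hi g3).ne
  rw [planeCross_swap (V k)] at s1
  rw [planeCross_swap (V i)] at s2
  rw [planeCross_swap (V j)] at s3
  unfold DirCyc
  rcases lt_or_gt_of_ne n1 with a1 | a1 <;> rcases lt_or_gt_of_ne n2 with a2 | a2 <;>
    rcases lt_or_gt_of_ne n3 with a3 | a3
  · linarith [s1 (by linarith)]
  · linarith [s2 (by linarith)]
  · linarith [s1 (by linarith)]
  · exact Or.inr (Or.inl ⟨a2, a3⟩)
  · linarith [s3 (by linarith)]
  · exact Or.inr (Or.inr ⟨a3, a1⟩)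
  · exact Or.inl ⟨a1, a2⟩
  · exact Or.inl ⟨a1, a2⟩

theorem Outward.dirCyc (hV : ParabolaCrossing N V) {i j k : ℕ} (hi : i < N) (hj : j < N) (hk : k < N)
    (h : CircLT i j k) (h1 : Outward V i) (h2 : Outward V j) (h3 : Outward V k) :
    DirCyc (V k) (V j) (V i) := by
  obtain ⟨g1, g2, g3⟩ := h.ne
  have s1 := h1.step hV hi hj hk h
  have s2 := h2.step hV hj hk hi h.rotate
  have s3 := h3.step hV hk hi hj h.rotate.rotate
  have n1 := (hV i hi j hj g1).ne
  have n2 := (hV j hj k hk g2).ne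
  have n3 := (hV k hk i hi g3).ne
  rw [planeCross_swap (V k)] at s1
  rw [planeCross_swap (V i)] at s2
  rw [planeCross_swap (V j)] at s3
  unfold DirCyc
  rw [planeCross_swap (V j) (V k), planeCross_swap (V i) (V j), planeCross_swap (V k) (V i)]
  simp only [neg_pos]
  rcases lt_or_gt_of_ne n1 with a1 | a1 <;> rcases lt_or_gt_of_ne n2 with a2 | a2 <;>
    rcases lt_or_gt_of_ne n3 with a3 | a3
  · exact Or.inl ⟨a2, a1⟩
  · exact Or.inl ⟨a2, a1⟩
  · exact Or.inr (Or.inl ⟨a1, a3⟩)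
  · linarith [s3 (by linarith)]
  · exact Or.inr (Or.inr ⟨a3, a2⟩)
  · linarith [s1 (by linarith)]
  · linarith [s2 (by linarith)]
  · linarith [s1 (by linarith)]

/-- Three apices `a`, `x`, `b` already force the sign of `planeCross (V a) (V b)`: going around the
triple with the step lemmas refutes the negative sign. The apex `y` on the other arc refutes the
positive one. -/
theorem ParabolaCrossing.not_alternate (hV : ParabolaCrossing N V) {a x b y : ℕ} (ha : a < N)
    (hx : x < N) (hb : b < N) (hy : y < N) (h1 : CircLT a x b) (h2 : CircLT b y a)
    (ka : Outward V a) (kb : Outward V b) (kx : Inward V x) (ky : Inward V y) : False := by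
  have aux : ∀ a b x, a < N → b < N → x < N → CircLT a x b → Outward V a → Outward V b →
      Inward V x → planeCross (V a) (V b) < 0 → False := by
    intro a b x ha hb hx h ka kb kx hX
    have s1 := ka.step hV ha hx hb h hX
    rw [planeCross_swap] at s1
    have s2 := kx.step hV hx hb ha h.rotate (by linarith)
    rw [planeCross_swap] at s2
    have s3 := kb.step hV hb ha hx h.rotate.rotate (by linarith)
    rw [planeCross_swap] at s3
    linarith
  have hab : a ≠ b := h1.ne.2.2.symm
  rcases lt_or_gt_of_ne (hV a ha b hb hab).ne with h | h
  · exact aux a b x ha hb hx h1 ka kb kx h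
  · exact aux b a y hb ha hy h2 kb ka ky (by rw [planeCross_swap]; linarith)

/-- `K` stands for either kind, inward or outward. Among the opposite-parity indices in the three
gaps of `i < j < k`, two agree about `K`: if both satisfy it, they separate the run; if neither
does, they violate `halt`. -/
theorem alternating_no_run {n : ℕ} {K : ℕ → Prop} {θ : ℕ → ℝ} {F : Finset ℕ}
    (hF : ∀ i ∈ F, i < 2 * n ∧ K i) (hpar : ∀ i ∈ F, ∀ j ∈ F, i % 2 = j % 2) (hcard : 3 ≤ F.card)
    (halt : ∀ a < 2 * n, ∀ x < 2 * n, ∀ b < 2 * n, ∀ y < 2 * n, CircLT a x b → CircLT b y a →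
      K a → K b → ¬ K x → ¬ K y → False)
    (hnat : ∀ i < 2 * n, ∀ j < 2 * n, ∀ k < 2 * n, CircLT i j k → K i → K j → K k →
      CircLT (θ i) (θ j) (θ k))
    (hsep : ∀ p ∈ F, ∀ q ∈ F, ∀ x < 2 * n, ∀ y < 2 * n, x % 2 ≠ p % 2 → y % 2 ≠ p % 2 →
      CircLT (θ p) (θ x) (θ q) → CircLT (θ q) (θ y) (θ p) → False) : False := by
  obtain ⟨i, hi, j, hj, k, hk, hij, hjk⟩ : ∃ i ∈ F, ∃ j ∈ F, ∃ k ∈ F, i < j ∧ j < k := by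
    let f := F.orderEmbOfCardLe hcard
    exact ⟨f 0, F.orderEmbOfCardLe_mem hcard 0, f 1, F.orderEmbOfCardLe_mem hcard 1, f 2,
      F.orderEmbOfCardLe_mem hcard 2, f.strictMono (by decide), f.strictMono (by decide)⟩
  have p1 := hpar i hi j hj
  have p2 := hpar j hj k hk
  obtain ⟨hi2, ki⟩ := hF i hi
  obtain ⟨hj2, kj⟩ := hF j hj
  obtain ⟨hk2, kk⟩ := hF k hk
  -- If `k` is the last index it is odd, so `0` has the opposite parity and lies below the odd index
  -- `i`.
  obtain ⟨z, hz, hzp, hz1⟩ : ∃ z < 2 * n, z % 2 ≠ i % 2 ∧ (k < z ∨ z < i) := by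
    by_cases h : k + 1 < 2 * n
    · exact ⟨k + 1, h, by omega, by omega⟩
    · exact ⟨0, by omega, by omega, by omega⟩
  have sep : ∀ p ∈ F, ∀ q ∈ F, ∀ x < 2 * n, ∀ y < 2 * n, x % 2 ≠ p % 2 → y % 2 ≠ p % 2 →
      CircLT p x q → CircLT q y p → K x → K y → False := by
    intro p hp q hq x hx y hy hxp hyp h1 h2 kx ky
    obtain ⟨hp2, kp⟩ := hF p hp
    obtain ⟨hq2, kq⟩ := hF q hq
    exact hsep p hp q hq x hx y hy hxp hyp (hnat p hp2 x hx q hq2 h1 kp kx kq)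
      (hnat q hq2 y hy p hp2 h2 kq ky kp)
  by_cases kx : K (i + 1)
  · by_cases ky : K (j + 1)
    · exact sep i hi j hj (i + 1) (by omega) (j + 1) (by omega) (by omega) (by omega)
        (by unfold CircLT; omega) (by unfold CircLT; omega) kx ky
    · by_cases kz : K z
      · exact sep i hi k hk (i + 1) (by omega) z hz (by omega) (by omega)
          (by unfold CircLT; omega) (by unfold CircLT; omega) kx kz
      · exact halt j hj2 (j + 1) (by omega) k hk2 z hz (by unfold CircLT; omega)
          (by unfold CircLT; omega) kj kk ky kz
  · by_cases ky : K (j + 1)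
    · by_cases kz : K z
      · exact sep j hj k hk (j + 1) (by omega) z hz (by omega) (by omega)
          (by unfold CircLT; omega) (by unfold CircLT; omega) ky kz
      · exact halt i hi2 (i + 1) (by omega) k hk2 z hz (by unfold CircLT; omega)
          (by unfold CircLT; omega) ki kk kx kz
    · exact halt i hi2 (i + 1) (by omega) j hj2 (j + 1) (by omega) (by unfold CircLT; omega)
          (by unfold CircLT; omega) ki kj kx ky

theorem ParabolaCrossing.no_run {n : ℕ} (hV : ParabolaCrossing (2 * n) V) {F : Finset ℕ}
    (hF : ∀ i ∈ F, i < 2 * n) (hpar : ∀ i ∈ F, ∀ j ∈ F, i % 2 = j % 2) (hcard : 5 ≤ F.card)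
    (hsep : ∀ p ∈ F, ∀ q ∈ F, ∀ x < 2 * n, ∀ y < 2 * n, x % 2 ≠ p % 2 → y % 2 ≠ p % 2 →
      CircLT (V p).arg (V x).arg (V q).arg → CircLT (V q).arg (V y).arg (V p).arg → False) :
    False := by
  classical
  have hsum := F.card_filter_add_card_filter_not (fun i => Inward V i)
  have hOut : ∀ i, ¬ Inward V i → Outward V i := fun i h => (not_le.mp h).le
  have hIn : ∀ i, ¬ Outward V i → Inward V i := fun i h => (not_le.mp h).le
  by_cases h3 : 3 ≤ (F.filter fun i => Inward V i).card
  · refine alternating_no_run (K := Inward V) (θ := fun i => (V i).arg) (n := n) ?_ ?_ h3 ?_ ?_ ?_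
    · intro i hi; rw [Finset.mem_filter] at hi; exact ⟨hF i hi.1, hi.2⟩
    · intro i hi j hj
      exact hpar i (Finset.mem_of_mem_filter i hi) j (Finset.mem_of_mem_filter j hj)
    · intro a ha x hx b hb y hy h1 h2 ka kb kx ky
      exact hV.not_alternate hx hb hy ha (by unfold CircLT at *; omega)
        (by unfold CircLT at *; omega) (hOut _ kx) (hOut _ ky) kb ka
    · intro i hi j hj k hk h ki kj kk
      exact (ki.dirCyc hV hi hj hk h kj kk).circLT
    · intro p hp q hq
      exact hsep p (Finset.mem_of_mem_filter p hp) q (Finset.mem_of_mem_filter q hq)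
  · have h4 : 3 ≤ (F.filter fun i => ¬ Inward V i).card := by omega
    -- Outward rays reverse the cyclic order of their apices, hence the negated argument and the
    -- exchange of `p` and `q` in `hsep`.
    refine alternating_no_run (K := Outward V) (θ := fun i => -(V i).arg) (n := n) ?_ ?_ h4 ?_ ?_ ?_
    · intro i hi; rw [Finset.mem_filter] at hi; exact ⟨hF i hi.1, hOut _ hi.2⟩
    · intro i hi j hj
      exact hpar i (Finset.mem_of_mem_filter i hi) j (Finset.mem_of_mem_filter j hj)
    · intro a ha x hx b hb y hy h1 h2 ka kb kx ky
      exact hV.not_alternate ha hx hb hy h1 h2 ka kb (hIn _ kx) (hIn _ ky)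
    · intro i hi j hj k hk h ki kj kk
      have := (ki.dirCyc hV hi hj hk h kj kk).circLT
      unfold CircLT at *
      simp only [neg_lt_neg_iff]
      tauto
    · intro p hp q hq x hx y hy hxp hyp h1 h2
      have hpF := Finset.mem_of_mem_filter p hp
      have hqF := Finset.mem_of_mem_filter q hq
      have hpq := hpar p hpF q hqF
      refine hsep q hqF p hpF x hx y hy (by omega) (by omega) ?_ ?_
      · unfold CircLT at *
        simp only [neg_lt_neg_iff] at h1
        tauto
      · unfold CircLT at *
        simp only [neg_lt_neg_iff] at h2
        tauto

end Parabola

/-! ### The alternating point set. -/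

theorem parabolaPoint_injective : Function.Injective parabolaPoint := by
  intro i j h
  have := congrArg Complex.re h
  simpa [parabolaPoint] using this

theorem not_collinear_of_planeCross {p q r : ℂ} (h : planeCross (q - p) (r - p) ≠ 0) :
    ¬ Collinear ℝ ({p, q, r} : Set ℂ) := by
  intro hc
  rw [collinear_iff_of_mem (p₀ := p) (by simp)] at hc
  obtain ⟨v, hv⟩ := hc
  obtain ⟨a, ha⟩ := hv q (by simp)
  obtain ⟨b, hb⟩ := hv r (by simp)
  apply h
  simp [ha, hb, planeCross]
  ring

/-- The alternately colored points of the parabola. -/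
noncomputable def alternatingSet (n : ℕ) : BichromaticPointSet n where
  red := (Finset.range n).image fun i => parabolaPoint (2 * i)
  blue := (Finset.range n).image fun i => parabolaPoint (2 * i + 1)
  disjoint := by
    rw [Finset.disjoint_left]
    intro x hx hy
    obtain ⟨i, -, rfl⟩ := Finset.mem_image.mp hx
    obtain ⟨j, -, h⟩ := Finset.mem_image.mp hy
    have := parabolaPoint_injective h
    omega
  card_red := by
    rw [Finset.card_image_of_injective, Finset.card_range]
    intro i j h
    have := parabolaPoint_injective h
    omega
  card_blue := by
    rw [Finset.card_image_of_injective, Finset.card_range]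
    intro i j h
    have := parabolaPoint_injective h
    omega

theorem mem_alternatingSet {n : ℕ} {p : ℂ} :
    p ∈ (alternatingSet n).points ↔ ∃ i < 2 * n, p = parabolaPoint i := by
  simp only [BichromaticPointSet.points, alternatingSet, Finset.mem_union, Finset.mem_image,
    Finset.mem_range]
  constructor
  · rintro (⟨i, hi, rfl⟩ | ⟨i, hi, rfl⟩)
    · exact ⟨2 * i, by omega, rfl⟩
    · exact ⟨2 * i + 1, by omega, rfl⟩
  · rintro ⟨i, hi, rfl⟩
    rcases Nat.even_or_odd' i with ⟨k, rfl | rfl⟩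
    · exact Or.inl ⟨k, by omega, rfl⟩
    · exact Or.inr ⟨k, by omega, rfl⟩

theorem alternatingSet_color {n i : ℕ} (hi : i < 2 * n) :
    (alternatingSet n).color (parabolaPoint i) = if i % 2 = 0 then RayColor.red else RayColor.blue := by
  have : parabolaPoint i ∈ (alternatingSet n).red ↔ i % 2 = 0 := by
    simp only [alternatingSet, Finset.mem_image, Finset.mem_range]
    constructor
    · rintro ⟨j, -, h⟩
      have := parabolaPoint_injective h
      omega
    · intro h
      exact ⟨i / 2, by omega, by congr 1; omega⟩
  simp only [BichromaticPointSet.color, this]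

theorem alternatingSet_color_eq_iff {n i j : ℕ} (hi : i < 2 * n) (hj : j < 2 * n) :
    (alternatingSet n).color (parabolaPoint i) = (alternatingSet n).color (parabolaPoint j) ↔
      i % 2 = j % 2 := by
  rw [alternatingSet_color hi, alternatingSet_color hj]
  split_ifs <;> simp <;> omega

theorem alternatingSet_generalPosition (n : ℕ) : (alternatingSet n).GeneralPosition := by
  intro p hp q hq r hr hpq hpr hqr
  obtain ⟨i, -, rfl⟩ := mem_alternatingSet.mp hp
  obtain ⟨j, -, rfl⟩ := mem_alternatingSet.mp hq
  obtain ⟨k, -, rfl⟩ := mem_alternatingSet.mp hr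
  apply not_collinear_of_planeCross
  rw [parabolaPoint_det]
  have h : ∀ {a b : ℕ}, parabolaPoint a ≠ parabolaPoint b → (b : ℝ) - a ≠ 0 := by
    intro a b hab h
    apply hab
    rw [sub_eq_zero] at h
    rw [Nat.cast_injective h]
  exact mul_ne_zero (mul_ne_zero (h hpq) (h hpr)) (h hqr)

theorem IsFullCrossing.crossSigns {n : ℕ} {S : BichromaticPointSet n} {v : ℂ → ℂ}
    (h : IsFullCrossing S v) {p q : ℂ} (hp : p ∈ S.points) (hq : q ∈ S.points) (hpq : p ≠ q) :
    CrossSigns p q (v p) (v q) :=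
  (h.2 p hp q hq hpq).crossSigns hpq (h.1 p hp) (h.1 q hq)

theorem not_chiFeasible_of_hasRun {n : ℕ} {C : Cycle RayColor} (hC : HasRun C) :
    ¬ ChiFeasible (alternatingSet n) C := by
  rintro ⟨v, hv, l, hl, hpw, rfl⟩
  obtain ⟨c, F, hF, hFc, hsep⟩ := HasRun.exists_finset (θ := fun p => (v p).arg) hpw hC
  have hmem : ∀ i < 2 * n, parabolaPoint i ∈ l := by
    intro i hi
    rw [← List.mem_toFinset, hl]
    exact mem_alternatingSet.mpr ⟨i, hi, rfl⟩
  set G := (Finset.range (2 * n)).filter (fun i => parabolaPoint i ∈ F) with hG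
  have hGm : ∀ i ∈ G, i < 2 * n ∧ parabolaPoint i ∈ F := by
    intro i hi; simpa [hG] using hi
  have hcol : ∀ i ∈ G, (alternatingSet n).color (parabolaPoint i) = c :=
    fun i hi => (hFc _ (hGm i hi).2).2
  have hFG : F = G.image parabolaPoint := by
    ext p
    simp only [hG, Finset.mem_image, Finset.mem_filter, Finset.mem_range]
    constructor
    · intro hp
      have hpl := (hFc p hp).1
      rw [← List.mem_toFinset, hl] at hpl
      obtain ⟨i, hi, rfl⟩ := mem_alternatingSet.mp hpl
      exact ⟨i, ⟨hi, hp⟩, rfl⟩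
    · rintro ⟨i, ⟨-, hi⟩, rfl⟩; exact hi
  have hV : ParabolaCrossing (2 * n) (fun i => v (parabolaPoint i)) := fun i hi j hj hij =>
    hv.crossSigns (mem_alternatingSet.mpr ⟨i, hi, rfl⟩) (mem_alternatingSet.mpr ⟨j, hj, rfl⟩)
      (parabolaPoint_injective.ne hij)
  refine hV.no_run (F := G) (fun i hi => (hGm i hi).1) ?_ ?_ ?_
  · intro i hi j hj
    rw [← alternatingSet_color_eq_iff (hGm i hi).1 (hGm j hj).1, hcol i hi, hcol j hj]
  · rw [← Finset.card_image_of_injective G parabolaPoint_injective, ← hFG, hF]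
  · intro p hp q hq x hx y hy hxp hyp
    refine hsep _ (hGm p hp).2 _ (hGm q hq).2 _ (hmem x hx) _ (hmem y hy) ?_ ?_
    · rwa [← hcol p hp, Ne, alternatingSet_color_eq_iff hx (hGm p hp).1]
    · rwa [← hcol p hp, Ne, alternatingSet_color_eq_iff hy (hGm p hp).1]

/-! ### Slopes, angles and the sector of the red rays. -/

/-- The cross product of the vector `(1, -w)` with `v`. -/
def slopeForm (w : ℝ) (v : ℂ) : ℝ := v.im + w * v.re

/-- The angle of `v` relative to the direction `1 + I`. -/
noncomputable def diagArg (v : ℂ) : ℝ := (v * (1 - Complex.I)).arg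

theorem planeCross_mul_diag (u w : ℂ) :
    planeCross (u * (1 - Complex.I)) (w * (1 - Complex.I)) = 2 * planeCross u w := by
  simp [planeCross]; ring

theorem mul_diag_re (v : ℂ) : (v * (1 - Complex.I)).re = slopeForm 1 v := by
  simp [slopeForm]; ring

theorem mul_diag_im (v : ℂ) : (v * (1 - Complex.I)).im = v.im - v.re := by
  simp; ring

theorem one_sub_I_ne_zero : (1 - Complex.I : ℂ) ≠ 0 := by
  intro h; simpa using congrArg Complex.re h

theorem neg_pi_div_two_le_diagArg {v : ℂ} (h : 0 ≤ slopeForm 1 v ∨ 0 ≤ slopeForm (1 / 2) v) :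
    -(Real.pi / 2) ≤ diagArg v := by
  by_cases h1 : 0 ≤ slopeForm 1 v
  · rw [← mul_diag_re] at h1
    exact (abs_le.mp (Complex.abs_arg_le_pi_div_two_iff.mpr h1)).1
  · have h2 := h.resolve_left h1
    have h3 : 0 ≤ (v * (1 - Complex.I)).im := by
      rw [mul_diag_im]; unfold slopeForm at *; linarith
    have := Complex.arg_nonneg_iff.mpr h3
    have := Real.pi_pos
    unfold diagArg; linarith

theorem slopeForm_pos_of_diagArg {v : ℂ} (hv : v ≠ 0) (h1 : -(Real.pi / 2) < diagArg v)
    (h2 : diagArg v < Real.pi / 2) : 0 < slopeForm 1 v := by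
  rw [← mul_diag_re]
  exact (Complex.abs_arg_lt_pi_div_two_iff.mp (abs_lt.mpr ⟨h1, h2⟩)).resolve_right
    (mul_ne_zero hv one_sub_I_ne_zero)

theorem diagArg_of_slopeForm_pos {v : ℂ} (h : 0 < slopeForm 1 v) :
    -(Real.pi / 2) < diagArg v ∧ diagArg v < Real.pi / 2 := by
  rw [← mul_diag_re] at h
  exact abs_lt.mp (Complex.abs_arg_lt_pi_div_two_iff.mpr (Or.inl h))

theorem slopeForm_nonpos_of_diagArg {v : ℂ} (h : Real.pi / 2 ≤ diagArg v) :
    slopeForm 1 v ≤ 0 := by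
  by_contra! h'
  linarith [(diagArg_of_slopeForm_pos h').2]

theorem slopeForm_neg_of_diagArg {v : ℂ} (h : Real.pi / 2 < diagArg v) :
    slopeForm 1 v < 0 := by
  by_contra! h'
  rw [← mul_diag_re] at h'
  have := (abs_le.mp (Complex.abs_arg_le_pi_div_two_iff.mpr h')).2
  unfold diagArg at h; linarith

theorem planeCross_pos_of_diagArg {u w : ℂ} (hu : u ≠ 0) (hw : w ≠ 0) (h : diagArg u < diagArg w)
    (h' : diagArg w - diagArg u < Real.pi) : 0 < planeCross u w := by
  have := planeCross_pos_of_arg (mul_ne_zero hu one_sub_I_ne_zero)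
    (mul_ne_zero hw one_sub_I_ne_zero) h h'
  rw [planeCross_mul_diag] at this; linarith

theorem planeCross_nonpos_of_diagArg {u w : ℂ} (h : Real.pi ≤ diagArg w - diagArg u) :
    planeCross u w ≤ 0 := by
  have := planeCross_nonpos_of_arg h
  rw [planeCross_mul_diag] at this; linarith

theorem diagArg_ne {u w : ℂ} (h : planeCross u w ≠ 0) : diagArg u ≠ diagArg w := by
  apply arg_ne_of_planeCross
  rw [planeCross_mul_diag]; simpa using h

theorem DirCyc.of_diagArg {u v w : ℂ} (h1 : planeCross u v ≠ 0) (h2 : planeCross v w ≠ 0)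
    (h3 : planeCross w u ≠ 0) (h : CircLT (diagArg u) (diagArg v) (diagArg w)) :
    DirCyc u v w := by
  have := DirCyc.of_circLT (u := u * (1 - Complex.I)) (v := v * (1 - Complex.I))
    (w := w * (1 - Complex.I)) (by rw [planeCross_mul_diag]; simpa using h1)
    (by rw [planeCross_mul_diag]; simpa using h2) (by rw [planeCross_mul_diag]; simpa using h3) h
  unfold DirCyc at *
  simp only [planeCross_mul_diag] at this
  simpa using this

/-- The sign conditions for crossing rays with directions `u`, `v` whose apices lie on a line of
slope `-w`; the factor `ε` records the orientation of the apices. -/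
structure SlopeSigns (ε w : ℝ) (u v : ℂ) : Prop where
  ne : planeCross u v ≠ 0
  pos : 0 < planeCross u v → 0 ≤ ε * slopeForm w u ∧ 0 ≤ ε * slopeForm w v
  neg : planeCross u v < 0 → ε * slopeForm w u ≤ 0 ∧ ε * slopeForm w v ≤ 0

theorem SlopeSigns.neg_dir {ε w : ℝ} {u v : ℂ} (h : SlopeSigns ε w u v) :
    SlopeSigns (-ε) w (-u) (-v) := by
  have e : planeCross (-u) (-v) = planeCross u v := by simp [planeCross]
  have f : ∀ x : ℂ, -ε * slopeForm w (-x) = ε * slopeForm w x := by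
    intro x; simp [slopeForm]; ring
  refine ⟨?_, ?_, ?_⟩ <;> rw [e] <;> try simp only [f]
  exacts [h.ne, h.pos, h.neg]

/-- `v` lies in the right half-plane and its slope is between `-w₀` and `-w₁`. -/
structure InSlopeCone (w₀ w₁ : ℝ) (v : ℂ) : Prop where
  re_pos : 0 < v.re
  left : 0 ≤ slopeForm w₀ v
  right : slopeForm w₁ v ≤ 0

/-- Crossing puts `v₀` and `b` weakly above slope `-w₀`, and `v₁` and `b` weakly below slope `-w₁`.
Once the real parts are known to be positive, angular order transfers both bounds to `v₀` and `v₁`.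
-/
theorem slopeCone_of_between {v₀ b v₁ : ℂ} {w₀ w₁ : ℝ}
    (hA₀ : 0 ≤ slopeForm 1 v₀ ∨ 0 ≤ slopeForm (1 / 2) v₀)
    (hA₁ : 0 ≤ slopeForm 1 v₁ ∨ 0 ≤ slopeForm (1 / 2) v₁)
    (h₀ : diagArg v₀ < diagArg b) (h₁ : diagArg b < diagArg v₁)
    (s₀ : SlopeSigns 1 w₀ v₀ b) (s₁ : SlopeSigns 1 w₁ v₁ b) (hw₁ : w₁ < 1 / 2) :
    InSlopeCone w₀ w₁ v₀ ∧ InSlopeCone w₀ w₁ v₁ := by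
  have hφ₀ := neg_pi_div_two_le_diagArg hA₀
  have hle : diagArg v₁ ≤ Real.pi := Complex.arg_le_pi _
  obtain ⟨hv₀, hb⟩ := ne_zero_of_planeCross s₀.ne
  obtain ⟨hv₁, -⟩ := ne_zero_of_planeCross s₁.ne
  obtain ⟨-, p₀, n₀⟩ := s₀
  obtain ⟨ne₁, p₁, n₁⟩ := s₁
  simp only [one_mul] at p₀ n₀ p₁ n₁
  have back : diagArg v₁ > Real.pi / 2 → v₁.re < 0 ∧ 0 ≤ slopeForm (1 / 2) v₁ := by
    intro h
    have h2 := slopeForm_neg_of_diagArg h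
    have h3 := hA₁.resolve_left (by linarith)
    refine ⟨?_, h3⟩
    unfold slopeForm at h2 h3; linarith
  -- An angular gap of at least `π` would put `v₁` beyond `π / 2`, where `back` applies and
  -- contradicts the crossing of `v₁` with `b`, because `w₁ < 1 / 2`.
  by_cases c₀ : diagArg b - diagArg v₀ < Real.pi
  · by_cases c₁ : diagArg v₁ - diagArg b < Real.pi
    · have x₀ := planeCross_pos_of_diagArg hv₀ hb h₀ c₀
      have x₁ := planeCross_pos_of_diagArg hb hv₁ h₁ c₁
      obtain ⟨a1, a2⟩ := p₀ x₀
      obtain ⟨a3, a4⟩ := n₁ (by rw [planeCross_swap]; linarith)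
      have r₁ : 0 < v₁.re := by
        by_contra! hr
        have hz : v₁.re = 0 := by
          unfold slopeForm at hA₁ a3
          rcases hA₁ with h | h <;> nlinarith
        apply hv₁
        refine Complex.ext hz ?_
        unfold slopeForm at hA₁ a3
        rw [hz] at hA₁ a3
        simp at hA₁ a3 ⊢
        linarith
      have fb : 0 < slopeForm 1 b := by
        refine slopeForm_pos_of_diagArg hb (by linarith) ?_
        by_contra! h
        linarith [(back (by linarith)).1]
      unfold planeCross at x₀ x₁
      unfold slopeForm at a1 a2 a3 a4 fb
      have rb : 0 < b.re := by
        by_contra! h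
        nlinarith
      have r₀ : 0 < v₀.re := by
        have : 0 < v₀.re * (b.im + w₀ * b.re) := by nlinarith [mul_nonneg a1 rb.le]
        exact pos_of_mul_pos_left this a2
      refine ⟨⟨r₀, a1, ?_⟩, ⟨r₁, ?_, a3⟩⟩
      · have : (v₀.im + w₁ * v₀.re) * b.re ≤ 0 := by nlinarith [mul_nonneg r₀.le (neg_nonneg.mpr a4)]
        exact nonpos_of_mul_nonpos_left this rb
      · have : 0 ≤ (v₁.im + w₀ * v₁.re) * b.re := by nlinarith [mul_nonneg r₁.le a2]
        exact nonneg_of_mul_nonneg_left this rb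
    · exfalso
      have x₁ : planeCross b v₁ ≤ 0 := planeCross_nonpos_of_diagArg (by linarith)
      rw [planeCross_swap] at x₁
      have x₂ : 0 < planeCross v₁ b := lt_of_le_of_ne (by linarith) ne₁.symm
      obtain ⟨-, a1⟩ := p₁ x₂
      have := Real.pi_pos
      have fb : 0 < slopeForm 1 b := slopeForm_pos_of_diagArg hb (by linarith) (by linarith)
      obtain ⟨a2, a3⟩ := back (by linarith)
      have a4 := slopeForm_neg_of_diagArg (v := v₁) (by linarith)
      unfold planeCross at x₂
      unfold slopeForm at a1 a3 a4 fb
      have rb : 0 < b.re := by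
        by_contra! h
        nlinarith
      have : b.im + 1 / 2 * b.re < 0 := by
        by_contra! h
        nlinarith
      nlinarith
  · exfalso
    have f₁ : Real.pi / 2 < diagArg v₁ := by linarith
    obtain ⟨a2, a3⟩ := back f₁
    have x₁ := planeCross_pos_of_diagArg hb hv₁ h₁ (by linarith)
    obtain ⟨-, a1⟩ := n₁ (by rw [planeCross_swap]; linarith)
    have fb := slopeForm_nonpos_of_diagArg (v := b) (by linarith)
    have a4 := slopeForm_neg_of_diagArg f₁
    unfold planeCross at x₁
    unfold slopeForm at a1 a3 a4 fb
    have rb : b.re < 0 := by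
      by_contra! h
      nlinarith
    have : 0 < b.im + 1 / 2 * b.re := by
      by_contra! h
      nlinarith
    nlinarith

theorem InSlopeCone.between {w₀ w₁ : ℝ} {v₀ b v₁ : ℂ} (h₀ : InSlopeCone w₀ w₁ v₀)
    (h₁ : InSlopeCone w₀ w₁ v₁) (hw : w₀ < 1) (hb : b ≠ 0) (a₀ : diagArg v₀ < diagArg b)
    (a₁ : diagArg b < diagArg v₁) :
    InSlopeCone w₀ w₁ b ∧ 0 < planeCross v₀ b ∧ 0 < planeCross b v₁ := by
  have f : ∀ v, InSlopeCone w₀ w₁ v → v ≠ 0 ∧ 0 < slopeForm 1 v := by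
    intro v h
    refine ⟨by rintro rfl; simpa using h.re_pos, ?_⟩
    have h1 := h.re_pos
    have h2 := h.left
    unfold slopeForm at *
    nlinarith
  obtain ⟨hv₀, g₀⟩ := f v₀ h₀
  obtain ⟨hv₁, g₁⟩ := f v₁ h₁
  obtain ⟨b1, b2⟩ := diagArg_of_slopeForm_pos g₀
  obtain ⟨b3, b4⟩ := diagArg_of_slopeForm_pos g₁
  have x₀ := planeCross_pos_of_diagArg hv₀ hb a₀ (by linarith)
  have x₁ := planeCross_pos_of_diagArg hb hv₁ a₁ (by linarith)
  have x := planeCross_pos_of_diagArg hv₀ hv₁ (by linarith) (by linarith)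
  -- Cramer's rule: `b` is a positive combination of `v₀` and `v₁`, and the cone is convex.
  have e : ∀ w, slopeForm w b * planeCross v₀ v₁ =
      slopeForm w v₀ * planeCross b v₁ + slopeForm w v₁ * planeCross v₀ b := by
    intro w; unfold slopeForm planeCross; ring
  have e' : b.re * planeCross v₀ v₁ = v₀.re * planeCross b v₁ + v₁.re * planeCross v₀ b := by
    unfold planeCross; ring
  refine ⟨⟨?_, ?_, ?_⟩, x₀, x₁⟩
  · refine pos_of_mul_pos_left ?_ x.le
    rw [e']
    exact add_pos (mul_pos h₀.re_pos x₁) (mul_pos h₁.re_pos x₀)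
  · refine nonneg_of_mul_nonneg_left ?_ x
    rw [e]
    exact add_nonneg (mul_nonneg h₀.left x₁.le) (mul_nonneg h₁.left x₀.le)
  · refine nonpos_of_mul_nonpos_left ?_ x
    rw [e]
    exact add_nonpos (mul_nonpos_of_nonpos_of_nonneg h₀.right x₁.le)
      (mul_nonpos_of_nonpos_of_nonneg h₁.right x₀.le)

/-- Here `c₀` and `c₁` have the extreme red angles. Blue rays outside the sector they bound come
after all red rays, counted counterclockwise from `c₀`. If some `m ∈ T` lies inside, its cone
contains every direction of the sector, so a second blue ray inside would have a slope belonging to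
two different blue parameters. -/
theorem exists_cut {R T D : Finset ℝ} {u : ℝ → ℂ} (hR : R.Nonempty)
    (hT : 5 ≤ T.card) (hTD : 6 ≤ (T ∪ D).card)
    (hA : ∀ c ∈ R, 0 ≤ slopeForm 1 (u c) ∨ 0 ≤ slopeForm (1 / 2) (u c))
    (hRR : ∀ c ∈ R, ∀ c' ∈ R, c ≠ c' → planeCross (u c) (u c') ≠ 0)
    (hRT : ∀ c ∈ R, ∀ m ∈ T, SlopeSigns 1 (m * c) (u c) (u m))
    (hRD : ∀ c ∈ R, ∀ m ∈ D, SlopeSigns (-1) (m * c) (u c) (u m))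
    (hw : ∀ c ∈ R, ∀ m ∈ T, m * c < 1 / 2)
    (hsep : ∀ m ∈ T ∪ D, ∀ m' ∈ T ∪ D, m ≠ m' → ∀ a ∈ R, ∀ b ∈ R, ∀ a' ∈ R, ∀ b' ∈ R, ∀ σ : ℝ,
      m * a ≤ σ → σ ≤ m * b → m' * a' ≤ σ → σ ≤ m' * b' → False) :
    ∃ c₀ ∈ R, ∃ T' ⊆ T ∪ D, 5 ≤ T'.card ∧
      ∀ c ∈ R, c ≠ c₀ → ∀ m ∈ T', DirCyc (u c₀) (u c) (u m) := by
  classical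
  obtain ⟨c₀, hc₀, hmin⟩ := R.exists_min_image (fun c => diagArg (u c)) hR
  obtain ⟨c₁, hc₁, hmax⟩ := R.exists_max_image (fun c => diagArg (u c)) hR
  have hne : ∀ c ∈ R, ∀ m ∈ T ∪ D, planeCross (u c) (u m) ≠ 0 := by
    intro c hc m hm
    rcases Finset.mem_union.mp hm with hm | hm
    exacts [(hRT c hc m hm).ne, (hRD c hc m hm).ne]
  refine ⟨c₀, hc₀, ?_⟩
  have cut : ∀ T' ⊆ T ∪ D, (∀ m ∈ T', ¬ (diagArg (u c₀) < diagArg (u m) ∧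
      diagArg (u m) < diagArg (u c₁))) →
      ∀ c ∈ R, c ≠ c₀ → ∀ m ∈ T', DirCyc (u c₀) (u c) (u m) := by
    intro T' hT' hno c hc hcc m hm
    have n1 := hRR c₀ hc₀ c hc hcc.symm
    have n2 := hne c hc m (hT' hm)
    have n3 := hne c₀ hc₀ m (hT' hm)
    refine DirCyc.of_diagArg n1 n2 (by rw [planeCross_swap]; simpa using n3) ?_
    have h1 := lt_of_le_of_ne (hmin c hc) (diagArg_ne n1)
    have h2 := hmax c hc
    have h3 := diagArg_ne n3
    have h4 := diagArg_ne (hne c₁ hc₁ m (hT' hm))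
    have h5 := hno m hm
    rcases lt_or_gt_of_ne h3 with h | h
    · left
      refine ⟨h1, ?_⟩
      by_contra h6
      exact h5 ⟨h, lt_of_le_of_ne (by linarith) h4.symm⟩
    · exact Or.inr (Or.inr ⟨h, h1⟩)
  by_cases hb : ∃ m ∈ T, diagArg (u c₀) < diagArg (u m) ∧ diagArg (u m) < diagArg (u c₁)
  · obtain ⟨m, hm, h1, h2⟩ := hb
    obtain ⟨k₀, k₁⟩ := slopeCone_of_between (hA c₀ hc₀) (hA c₁ hc₁) h1 h2 (hRT c₀ hc₀ m hm)
      (hRT c₁ hc₁ m hm) (hw c₁ hc₁ m hm)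
    have hw₀ := hw c₀ hc₀ m hm
    refine ⟨(T ∪ D).erase m, Finset.erase_subset _ _, ?_, cut _ (Finset.erase_subset _ _) ?_⟩
    · rw [Finset.card_erase_of_mem (Finset.mem_union_left D hm)]; omega
    · rintro m' hm' ⟨h3, h4⟩
      obtain ⟨hmm, hmT⟩ := Finset.mem_erase.mp hm'
      obtain ⟨k, x₀, x₁⟩ := k₀.between k₁ (by linarith)
        (ne_zero_of_planeCross (hne c₀ hc₀ m' hmT)).2 h3 h4
      have kr := k.re_pos
      -- The number `σ` fed to `hsep` is minus the slope of `u m'`; for `m' ∈ D` the bounds from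
      -- `c₀` and `c₁` change places.
      have conv1 : ∀ w, 0 ≤ slopeForm w (u m') → -(u m').im / (u m').re ≤ w := by
        intro w h; rw [div_le_iff₀ kr]; unfold slopeForm at h; linarith
      have conv2 : ∀ w, slopeForm w (u m') ≤ 0 → w ≤ -(u m').im / (u m').re := by
        intro w h; rw [le_div_iff₀ kr]; unfold slopeForm at h; linarith
      have x₁' : planeCross (u c₁) (u m') < 0 := by rw [planeCross_swap]; linarith
      have hs := hsep m (Finset.mem_union_left D hm) m' hmT hmm.symm c₁ hc₁ c₀ hc₀
      rcases Finset.mem_union.mp hmT with hm2 | hm2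
      · refine hs c₁ hc₁ c₀ hc₀ _ (conv2 _ k.right) (conv1 _ k.left) (conv2 _ ?_) (conv1 _ ?_)
        · have := ((hRT c₁ hc₁ m' hm2).neg x₁').2; linarith
        · have := ((hRT c₀ hc₀ m' hm2).pos x₀).2; linarith
      · refine hs c₀ hc₀ c₁ hc₁ _ (conv2 _ k.right) (conv1 _ k.left) (conv2 _ ?_) (conv1 _ ?_)
        · have := ((hRD c₀ hc₀ m' hm2).pos x₀).2; linarith
        · have := ((hRD c₁ hc₁ m' hm2).neg x₁').2; linarith
  · exact ⟨T, Finset.subset_union_left, hT, cut T Finset.subset_union_left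
      fun m hm h => hb ⟨m, hm, h⟩⟩

/-! ### The point set on the hyperbola. -/

/-- The points of the hyperbola `x * y = 1`. -/
noncomputable def hyperbolaPoint (c : ℝ) : ℂ := ⟨1 / c, c⟩

theorem hyperbolaPoint_injective : Function.Injective hyperbolaPoint := fun _ _ h =>
  congrArg Complex.im h

theorem hyperbolaPoint_cross {c d : ℝ} (hc : c ≠ 0) (hd : d ≠ 0) (v : ℂ) :
    planeCross (hyperbolaPoint d - hyperbolaPoint c) v
      = (c - d) / (d * c) * slopeForm (d * c) v := by
  simp [planeCross, hyperbolaPoint, slopeForm]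
  field_simp
  ring

theorem hyperbolaPoint_det {a b c : ℝ} (ha : a ≠ 0) (hb : b ≠ 0) (hc : c ≠ 0) (hab : a ≠ b)
    (hac : a ≠ c) (hbc : b ≠ c) :
    planeCross (hyperbolaPoint b - hyperbolaPoint a) (hyperbolaPoint c - hyperbolaPoint a) ≠ 0 := by
  have : planeCross (hyperbolaPoint b - hyperbolaPoint a) (hyperbolaPoint c - hyperbolaPoint a)
      = (a - b) * (c - a) * (c - b) / (a * b * c) := by
    rw [hyperbolaPoint_cross ha hb]
    simp [slopeForm, hyperbolaPoint]
    field_simp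
    ring
  rw [this]
  exact div_ne_zero (mul_ne_zero (mul_ne_zero (sub_ne_zero.mpr hab) (sub_ne_zero.mpr hac.symm))
    (sub_ne_zero.mpr hbc.symm)) (mul_ne_zero (mul_ne_zero ha hb) hc)

theorem CrossSigns.slopeSigns {c m : ℝ} {u w : ℂ} (hc : c ≠ 0) (hm : m ≠ 0)
    (h : CrossSigns (hyperbolaPoint c) (hyperbolaPoint m) u w) {ε : ℝ}
    (hε : 0 < ε * ((c - m) / (m * c))) : SlopeSigns ε (m * c) u w := by
  obtain ⟨h1, h2, h3⟩ := h
  simp only [hyperbolaPoint_cross hc hm] at h2 h3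
  generalize (c - m) / (m * c) = k at *
  have hk : k ≠ 0 := by rintro rfl; simp at hε
  have e : ∀ x : ℂ, ε * slopeForm (m * c) x = (ε * k) / k ^ 2 * (k * slopeForm (m * c) x) := by
    intro x; field_simp
  have hk2 : 0 ≤ (ε * k) / k ^ 2 := by positivity
  refine ⟨h1, fun h => ?_, fun h => ?_⟩ <;> simp only [e]
  · exact ⟨mul_nonneg hk2 (h2 h).1, mul_nonneg hk2 (h2 h).2⟩
  · exact ⟨mul_nonpos_of_nonneg_of_nonpos hk2 (h3 h).1, mul_nonpos_of_nonneg_of_nonpos hk2 (h3 h).2⟩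

/-- The parameters of the red points. -/
noncomputable def redParams (n : ℕ) : Finset ℝ :=
  -- Dividing by `n ^ 2` keeps all red parameters within `1 / n` of `1`, less than the relative gap
  -- between neighboring blue parameters.
  (Finset.range n).image fun i : ℕ => 1 - (i : ℝ) / (n : ℝ) ^ 2

/-- The parameters of the blue points on the branch of the red points. -/
noncomputable def upParams (n : ℕ) : Finset ℝ :=
  -- Five points suffice for a run, and `10 ≤ n` leaves at least five for the other branch. The
  -- denominator `2 * n` keeps blue parameters below `1 / 2` in absolute value.
  (Finset.range 5).image fun k : ℕ => ((k : ℝ) + 1) / (2 * n)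

/-- The parameters of the blue points on the other branch. -/
noncomputable def downParams (n : ℕ) : Finset ℝ :=
  (Finset.range (n - 5)).image fun k : ℕ => -(((k : ℝ) + 1) / (2 * n))

section Params

variable {n : ℕ}

theorem mem_redParams (hn : 10 ≤ n) {c : ℝ} (hc : c ∈ redParams n) :
    1 - 1 / (n : ℝ) < c ∧ c ≤ 1 := by
  obtain ⟨i, hi, rfl⟩ := Finset.mem_image.mp hc
  have hi : (i : ℝ) < n := by exact_mod_cast Finset.mem_range.mp hi
  have hn0 : (0 : ℝ) < n := by positivity
  have h1 : (i : ℝ) / (n : ℝ) ^ 2 < 1 / n := by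
    rw [div_lt_div_iff₀ (by positivity) hn0]; nlinarith
  have h2 : 0 ≤ (i : ℝ) / (n : ℝ) ^ 2 := by positivity
  constructor <;> linarith

theorem redParams_ge (hn : 10 ≤ n) {c : ℝ} (hc : c ∈ redParams n) : 9 / 10 < c := by
  have h := (mem_redParams hn hc).1
  have hn' : (10 : ℝ) ≤ n := by exact_mod_cast hn
  have : 1 / (n : ℝ) ≤ 1 / 10 := one_div_le_one_div_of_le (by norm_num) hn'
  linarith

theorem mem_upParams (hn : 10 ≤ n) {m : ℝ} (hm : m ∈ upParams n) :
    ∃ k : ℤ, 0 < k ∧ k ≤ n ∧ 2 * n * m = k ∧ 0 < m ∧ m ≤ 1 / 4 := by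
  obtain ⟨k, hk, rfl⟩ := Finset.mem_image.mp hm
  have hk := Finset.mem_range.mp hk
  have hn' : (10 : ℝ) ≤ n := by exact_mod_cast hn
  have hk' : (k : ℝ) + 1 ≤ 5 := by exact_mod_cast hk
  refine ⟨k + 1, by omega, by omega, ?_, by positivity, ?_⟩
  · push_cast; field_simp
  · rw [div_le_iff₀ (by positivity)]; linarith

theorem mem_downParams (hn : 10 ≤ n) {m : ℝ} (hm : m ∈ downParams n) :
    ∃ k : ℤ, k < 0 ∧ -k ≤ n ∧ 2 * n * m = k ∧ m < 0 ∧ -1 / 2 < m := by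
  obtain ⟨k, hk, rfl⟩ := Finset.mem_image.mp hm
  have hk := Finset.mem_range.mp hk
  have hn' : (10 : ℝ) ≤ n := by exact_mod_cast hn
  have hk' : (k : ℝ) + 1 < n := by exact_mod_cast (by omega : k + 1 < n)
  refine ⟨-(k + 1), by omega, by omega, ?_, ?_, ?_⟩
  · push_cast; field_simp
  · rw [neg_lt_zero]; positivity
  · have : ((k : ℝ) + 1) / (2 * n) < 1 / 2 := by
      rw [div_lt_iff₀ (by positivity)]; linarith
    linarith

theorem disjoint_upParams_downParams (hn : 10 ≤ n) : Disjoint (upParams n) (downParams n) := by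
  rw [Finset.disjoint_left]
  intro m h1 h2
  obtain ⟨_, -, -, -, h, -⟩ := mem_upParams hn h1
  obtain ⟨_, -, -, -, h', -⟩ := mem_downParams hn h2
  linarith

theorem card_redParams (hn : 10 ≤ n) : (redParams n).card = n := by
  have hn0 : (n : ℝ) ≠ 0 := by positivity
  rw [redParams, Finset.card_image_of_injective, Finset.card_range]
  intro i j h
  have h : (i : ℝ) / (n : ℝ) ^ 2 = (j : ℝ) / (n : ℝ) ^ 2 := by simpa using h
  rw [div_left_inj' (by positivity)] at h
  exact_mod_cast h

theorem card_upParams (hn : 10 ≤ n) : (upParams n).card = 5 := by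
  have hn0 : (n : ℝ) ≠ 0 := by positivity
  rw [upParams, Finset.card_image_of_injective, Finset.card_range]
  intro i j h
  rw [div_left_inj' (by positivity)] at h
  exact_mod_cast add_right_cancel h

theorem card_downParams (hn : 10 ≤ n) : (downParams n).card = n - 5 := by
  have hn0 : (n : ℝ) ≠ 0 := by positivity
  rw [downParams, Finset.card_image_of_injective, Finset.card_range]
  intro i j h
  rw [neg_inj, div_left_inj' (by positivity)] at h
  exact_mod_cast add_right_cancel h

theorem card_blueParams (hn : 10 ≤ n) : (upParams n ∪ downParams n).card = n := by
  rw [Finset.card_union_of_disjoint (disjoint_upParams_downParams hn), card_upParams hn,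
    card_downParams hn]
  omega

theorem mem_blueParams (hn : 10 ≤ n) {m : ℝ} (hm : m ∈ upParams n ∪ downParams n) :
    m ≠ 0 ∧ |m| < 1 / 2 ∧ ∃ k : ℤ, k ≠ 0 ∧ |k| ≤ n ∧ 2 * n * m = k := by
  rcases Finset.mem_union.mp hm with h | h
  · obtain ⟨k, h1, h2, h3, h4, h5⟩ := mem_upParams hn h
    exact ⟨h4.ne', by rw [abs_of_pos h4]; linarith, k, h1.ne', by rwa [abs_of_pos h1], h3⟩
  · obtain ⟨k, h1, h2, h3, h4, h5⟩ := mem_downParams hn h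
    exact ⟨h4.ne, by rw [abs_of_neg h4]; linarith, k, h1.ne, by rwa [abs_of_neg h1], h3⟩

/-- Put `k = 2 * n * m`, an integer with `|k| ≤ n`. As `c` runs over the red parameters, `k * c`
stays in `(k - 1, k]` if `k > 0` and in `[k, k + 1)` if `k < 0`; these intervals are disjoint for
different `k`. -/
theorem blueParams_separated (hn : 10 ≤ n) {m m' : ℝ} (hm : m ∈ upParams n ∪ downParams n)
    (hm' : m' ∈ upParams n ∪ downParams n) (hne : m ≠ m') {a b a' b' : ℝ} (ha : a ∈ redParams n)
    (hb : b ∈ redParams n) (ha' : a' ∈ redParams n) (hb' : b' ∈ redParams n) {σ : ℝ}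
    (h1 : m * a ≤ σ) (h2 : σ ≤ m * b) (h3 : m' * a' ≤ σ) (h4 : σ ≤ m' * b') : False := by
  have hn0 : (0 : ℝ) < n := by positivity
  have bound : ∀ m ∈ upParams n ∪ downParams n, ∀ a ∈ redParams n, ∀ b ∈ redParams n,
      m * a ≤ σ → σ ≤ m * b → ∃ k : ℤ, 2 * n * m = k ∧
        ((0 < k ∧ k - 1 < 2 * n * σ ∧ 2 * n * σ ≤ k) ∨
          (k < 0 ∧ k ≤ 2 * n * σ ∧ 2 * n * σ < k + 1)) := by
    intro m hm a ha b hb h1 h2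
    obtain ⟨-, -, k, hk0, hkn, hk⟩ := mem_blueParams hn hm
    obtain ⟨a1, a2⟩ := mem_redParams hn ha
    obtain ⟨b1, b2⟩ := mem_redParams hn hb
    have c1 : (k : ℝ) * a ≤ 2 * n * σ := by rw [← hk]; nlinarith
    have c2 : 2 * n * σ ≤ (k : ℝ) * b := by rw [← hk]; nlinarith
    have hkn' : |(k : ℝ)| ≤ n := by exact_mod_cast hkn
    refine ⟨k, hk, ?_⟩
    have hq : |(k : ℝ)| * (1 / n) ≤ 1 := by
      rw [mul_one_div, div_le_one hn0]; exact hkn'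
    rcases lt_or_gt_of_ne hk0 with h | h
    · have h' : (k : ℝ) < 0 := by exact_mod_cast h
      rw [abs_of_neg h'] at hq
      exact Or.inr ⟨h, by nlinarith, by nlinarith⟩
    · have h' : (0 : ℝ) < k := by exact_mod_cast h
      rw [abs_of_pos h'] at hq
      exact Or.inl ⟨h, by nlinarith, by nlinarith⟩
  obtain ⟨k, hk, hk'⟩ := bound m hm a ha b hb h1 h2
  obtain ⟨l, hl, hl'⟩ := bound m' hm' a' ha' b' hb' h3 h4
  have hkl : k ≠ l := by
    rintro rfl
    apply hne
    rw [← hl] at hk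
    exact mul_left_cancel₀ (by positivity) hk
  generalize 2 * n * σ = s at *
  rcases hk' with ⟨k1, k2, k3⟩ | ⟨k1, k2, k3⟩ <;> rcases hl' with ⟨l1, l2, l3⟩ | ⟨l1, l2, l3⟩
  · have x1 : (k : ℝ) < l + 1 := by linarith
    have x2 : (l : ℝ) < k + 1 := by linarith
    norm_cast at x1 x2
    omega
  · have x1 : (k : ℝ) < l + 2 := by linarith
    norm_cast at x1
    omega
  · have x1 : (l : ℝ) < k + 2 := by linarith
    norm_cast at x1
    omega
  · have x1 : (k : ℝ) < l + 1 := by linarith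
    have x2 : (l : ℝ) < k + 1 := by linarith
    norm_cast at x1 x2
    omega

/-- Red points on a short arc of the hyperbola, and blue points on both branches. -/
noncomputable def hyperbolaSet (n : ℕ) (hn : 10 ≤ n) : BichromaticPointSet n where
  red := (redParams n).image hyperbolaPoint
  blue := (upParams n ∪ downParams n).image hyperbolaPoint
  disjoint := by
    rw [Finset.disjoint_image hyperbolaPoint_injective, Finset.disjoint_left]
    intro c hc hc'
    have h1 := redParams_ge hn hc
    have h2 := (mem_blueParams hn hc').2.1
    have := le_abs_self c
    linarith
  card_red := by
    rw [Finset.card_image_of_injective _ hyperbolaPoint_injective, card_redParams hn]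
  card_blue := by
    rw [Finset.card_image_of_injective _ hyperbolaPoint_injective, card_blueParams hn]

theorem hyperbolaSet_red_mem {hn : 10 ≤ n} {c : ℝ} :
    hyperbolaPoint c ∈ (hyperbolaSet n hn).red ↔ c ∈ redParams n := by
  simp [hyperbolaSet, hyperbolaPoint_injective.eq_iff]

theorem hyperbolaSet_blue_mem {hn : 10 ≤ n} {c : ℝ} :
    hyperbolaPoint c ∈ (hyperbolaSet n hn).blue ↔ c ∈ upParams n ∪ downParams n := by
  rw [hyperbolaSet, hyperbolaPoint_injective.mem_finset_image]

theorem mem_hyperbolaSet {hn : 10 ≤ n} {p : ℂ} (hp : p ∈ (hyperbolaSet n hn).points) :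
    ∃ c ≠ 0, p = hyperbolaPoint c := by
  rcases Finset.mem_union.mp hp with h | h
  · obtain ⟨c, hc, rfl⟩ := Finset.mem_image.mp h
    have := redParams_ge hn hc
    exact ⟨c, by linarith, rfl⟩
  · obtain ⟨c, hc, rfl⟩ := Finset.mem_image.mp h
    exact ⟨c, (mem_blueParams hn hc).1, rfl⟩

theorem hyperbolaSet_generalPosition (hn : 10 ≤ n) : (hyperbolaSet n hn).GeneralPosition := by
  intro p hp q hq r hr hpq hpr hqr
  obtain ⟨a, ha, rfl⟩ := mem_hyperbolaSet hp
  obtain ⟨b, hb, rfl⟩ := mem_hyperbolaSet hq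
  obtain ⟨c, hc, rfl⟩ := mem_hyperbolaSet hr
  exact not_collinear_of_planeCross (hyperbolaPoint_det ha hb hc (fun h => hpq (by rw [h]))
    (fun h => hpr (by rw [h])) (fun h => hqr (by rw [h])))

/-- Crossing rays point weakly to the same side of the line through their apices. For two red apices
`w = d * c` lies in `(1 / 2, 1]`, so `slopeForm w` is a convex combination of the two extreme forms,
and strict opposite signs of these are impossible. -/
theorem slopeForm_sides {R : Finset ℝ} {u : ℝ → ℂ} (hR : ∀ c ∈ R, 9 / 10 < c ∧ c ≤ 1)
    (hV : ∀ c ∈ R, ∀ d ∈ R, c ≠ d → CrossSigns (hyperbolaPoint c) (hyperbolaPoint d) (u c) (u d)) :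
    (∀ c ∈ R, 0 ≤ slopeForm 1 (u c) ∨ 0 ≤ slopeForm (1 / 2) (u c)) ∨
      ∀ c ∈ R, slopeForm 1 (u c) ≤ 0 ∨ slopeForm (1 / 2) (u c) ≤ 0 := by
  by_contra! h
  obtain ⟨⟨c, hc, c1, c2⟩, d, hd, d1, d2⟩ := h
  have hcd : c ≠ d := by rintro rfl; linarith
  obtain ⟨r1, r2⟩ := hR c hc
  obtain ⟨r3, r4⟩ := hR d hd
  obtain ⟨h0, h1, h2⟩ := hV c hc d hd hcd
  simp only [hyperbolaPoint_cross (by linarith : c ≠ 0) (by linarith : d ≠ 0)] at h1 h2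
  have hw1 : 1 / 2 < d * c := by nlinarith
  have hw2 : d * c ≤ 1 := by nlinarith
  generalize d * c = w at *
  have e : ∀ x : ℂ, slopeForm w x =
      (2 * w - 1) * slopeForm 1 x + (2 - 2 * w) * slopeForm (1 / 2) x := by
    intro x; unfold slopeForm; ring
  have s1 : slopeForm w (u c) < 0 := by
    rw [e]
    exact add_neg_of_neg_of_nonpos (mul_neg_of_pos_of_neg (by linarith) c1)
      (mul_nonpos_of_nonneg_of_nonpos (by linarith) c2.le)
  have s2 : 0 < slopeForm w (u d) := by
    rw [e]
    exact add_pos_of_pos_of_nonneg (mul_pos (by linarith) d1) (mul_nonneg (by linarith) d2.le)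
  have hk : (c - d) / w ≠ 0 := div_ne_zero (sub_ne_zero.mpr hcd) (by linarith)
  generalize (c - d) / w = k at *
  rcases lt_or_gt_of_ne h0 with h | h <;> rcases lt_or_gt_of_ne hk with hk | hk <;>
  [obtain ⟨g1, g2⟩ := h2 h; obtain ⟨g1, g2⟩ := h2 h; obtain ⟨g1, g2⟩ := h1 h;
    obtain ⟨g1, g2⟩ := h1 h] <;> nlinarith

/-- The two alternatives of `slopeForm_sides` are exchanged by negating all directions. This
preserves cross products and `DirCyc` but flips the orientation `ε`, so the two blue branches swap
the roles of `T` and `D`. -/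
theorem hasRun_of_chiFeasible (hn : 10 ≤ n) {C : Cycle RayColor}
    (h : ChiFeasible (hyperbolaSet n hn) C) : HasRun C := by
  obtain ⟨v, hv, l, hl, hpw, rfl⟩ := h
  set u : ℝ → ℂ := fun c => v (hyperbolaPoint c) with hu
  have hred : ∀ c ∈ redParams n, hyperbolaPoint c ∈ (hyperbolaSet n hn).points := fun c hc =>
    Finset.mem_union_left _ (hyperbolaSet_red_mem.mpr hc)
  have hblue : ∀ c ∈ upParams n ∪ downParams n,
      hyperbolaPoint c ∈ (hyperbolaSet n hn).points := fun c hc =>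
    Finset.mem_union_right _ (hyperbolaSet_blue_mem.mpr hc)
  have hmemu : ∀ m ∈ upParams n, m ∈ upParams n ∪ downParams n :=
    fun m hm => Finset.mem_union_left _ hm
  have hmemd : ∀ m ∈ downParams n, m ∈ upParams n ∪ downParams n :=
    fun m hm => Finset.mem_union_right _ hm
  have hlt : ∀ c ∈ redParams n, ∀ m ∈ upParams n ∪ downParams n, m < c := by
    intro c hc m hm
    have := redParams_ge hn hc
    have := (mem_blueParams hn hm).2.1
    linarith [le_abs_self m]
  have hRR : ∀ c ∈ redParams n, ∀ d ∈ redParams n, c ≠ d →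
      CrossSigns (hyperbolaPoint c) (hyperbolaPoint d) (u c) (u d) := fun c hc d hd hcd =>
    hv.crossSigns (hred c hc) (hred d hd) (hyperbolaPoint_injective.ne hcd)
  have hRB : ∀ c ∈ redParams n, ∀ m ∈ upParams n ∪ downParams n,
      CrossSigns (hyperbolaPoint c) (hyperbolaPoint m) (u c) (u m) := fun c hc m hm =>
    hv.crossSigns (hred c hc) (hblue m hm) (hyperbolaPoint_injective.ne (hlt c hc m hm).ne')
  have hRU : ∀ c ∈ redParams n, ∀ m ∈ upParams n, SlopeSigns 1 (m * c) (u c) (u m) := by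
    intro c hc m hm
    obtain ⟨_, -, -, -, h, -⟩ := mem_upParams hn hm
    have h1 := redParams_ge hn hc
    have h2 := hlt c hc m (hmemu m hm)
    refine (hRB c hc m (hmemu m hm)).slopeSigns (by linarith) h.ne' ?_
    rw [one_mul]
    exact div_pos (by linarith) (mul_pos h (by linarith))
  have hRD : ∀ c ∈ redParams n, ∀ m ∈ downParams n, SlopeSigns (-1) (m * c) (u c) (u m) := by
    intro c hc m hm
    obtain ⟨_, -, -, -, h, -⟩ := mem_downParams hn hm
    have h1 := redParams_ge hn hc
    have h2 := hlt c hc m (hmemd m hm)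
    refine (hRB c hc m (hmemd m hm)).slopeSigns (by linarith) h.ne ?_
    have := div_neg_of_pos_of_neg (sub_pos.mpr h2) (mul_neg_of_neg_of_pos h (by linarith : 0 < c))
    linarith
  have hne : (redParams n).Nonempty := by
    rw [← Finset.card_pos, card_redParams hn]; omega
  have main : ∃ c₀ ∈ redParams n, ∃ T ⊆ upParams n ∪ downParams n, 5 ≤ T.card ∧
      ∀ c ∈ redParams n, c ≠ c₀ → ∀ m ∈ T, DirCyc (u c₀) (u c) (u m) := by
    rcases slopeForm_sides (fun c hc => ⟨redParams_ge hn hc, (mem_redParams hn hc).2⟩) hRR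
      with hA | hA
    · refine exists_cut hne (card_upParams hn).ge (by rw [card_blueParams hn]; omega) hA
        (fun c hc d hd hcd => (hRR c hc d hd hcd).ne) hRU hRD ?_ ?_
      · intro c hc m hm
        obtain ⟨_, -, -, -, h, h'⟩ := mem_upParams hn hm
        have h1 := redParams_ge hn hc
        have h2 := (mem_redParams hn hc).2
        nlinarith
      · intro m hm m' hm' hmm a ha b hb a' ha' b' hb' σ
        exact blueParams_separated hn hm hm' hmm ha hb ha' hb'
    · have e : ∀ x y : ℂ, planeCross (-x) (-y) = planeCross x y := by
        intro x y; simp [planeCross]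
      have hcyc : ∀ x y z : ℂ, DirCyc (-x) (-y) (-z) → DirCyc x y z := by
        intro x y z h; simpa only [DirCyc, e] using h
      rw [Finset.union_comm] at hmemu ⊢
      suffices hx : ∃ c₀ ∈ redParams n, ∃ T ⊆ downParams n ∪ upParams n, 5 ≤ T.card ∧
          ∀ c ∈ redParams n, c ≠ c₀ → ∀ m ∈ T, DirCyc (-u c₀) (-u c) (-u m) by
        obtain ⟨c₀, hc₀, T, hT, hcard, h⟩ := hx
        exact ⟨c₀, hc₀, T, hT, hcard, fun c hc hcc m hm => hcyc _ _ _ (h c hc hcc m hm)⟩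
      refine exists_cut (u := fun c => -u c) hne (by rw [card_downParams hn]; omega)
        (by rw [Finset.union_comm, card_blueParams hn]; omega) ?_ ?_ ?_ ?_ ?_ ?_
      · intro c hc
        have e' : ∀ w, slopeForm w (-u c) = -slopeForm w (u c) := by
          intro w; simp [slopeForm]; ring
        simpa only [e', neg_nonneg] using hA c hc
      · intro c hc d hd hcd
        rw [e]; exact (hRR c hc d hd hcd).ne
      · intro c hc m hm
        simpa using (hRD c hc m hm).neg_dir
      · intro c hc m hm
        exact (hRU c hc m hm).neg_dir
      · intro c hc m hm
        obtain ⟨_, -, -, -, h, -⟩ := mem_downParams hn hm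
        have h1 := redParams_ge hn hc
        nlinarith
      · intro m hm m' hm' hmm a ha b hb a' ha' b' hb' σ
        rw [Finset.union_comm] at hm hm'
        exact blueParams_separated hn hm hm' hmm ha hb ha' hb'
  obtain ⟨c₀, hc₀, T, hT, hcard, hcut⟩ := main
  have hmem : ∀ p ∈ (hyperbolaSet n hn).points, p ∈ l := by
    intro p hp; rwa [← List.mem_toFinset, hl]
  have hcol : ∀ p, (hyperbolaSet n hn).color p ≠ RayColor.blue → p ∈ (hyperbolaSet n hn).red := by
    intro p hp
    by_contra h
    exact hp (if_neg h)
  refine HasRun.of_cut (θ := fun p => (v p).arg) hpw (c := RayColor.blue)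
    (r₀ := hyperbolaPoint c₀) (hmem _ (hred c₀ hc₀)) ?_ (T := T.image hyperbolaPoint) ?_ ?_ ?_
  · rw [BichromaticPointSet.color, if_pos (hyperbolaSet_red_mem.mpr hc₀)]
    decide
  · rwa [Finset.card_image_of_injective _ hyperbolaPoint_injective]
  · intro b hb
    obtain ⟨m, hm, rfl⟩ := Finset.mem_image.mp hb
    refine ⟨hmem _ (hblue m (hT hm)), if_neg fun h => ?_⟩
    exact (hlt m (hyperbolaSet_red_mem.mp h) m (hT hm)).false
  · intro r _ hr0 hr b hb
    obtain ⟨m, hm, rfl⟩ := Finset.mem_image.mp hb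
    obtain ⟨c, hc, rfl⟩ := Finset.mem_image.mp (hcol r hr)
    exact (hcut c hc (fun h => hr0 (by rw [h])) m hm).circLT

end Params

theorem mainTheorem10 (n : ℕ) (hn : 20 ≤ 2 * n) :
    (¬ ∃ C : Cycle RayColor, IsConfiguration n C ∧ UniversalForFullCrossing n C) ∧
    ∀ C : Cycle RayColor, IsConfiguration n C →
      ∃ S : BichromaticPointSet n, S.GeneralPosition ∧ ¬ ChiFeasible S C := by
  have hn' : 10 ≤ n := by omega
  have key : ∀ C : Cycle RayColor,
      ∃ S : BichromaticPointSet n, S.GeneralPosition ∧ ¬ ChiFeasible S C := by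
    intro C
    by_cases hC : HasRun C
    · exact ⟨alternatingSet n, alternatingSet_generalPosition n, not_chiFeasible_of_hasRun hC⟩
    · exact ⟨hyperbolaSet n hn', hyperbolaSet_generalPosition hn',
        fun h => hC (hasRun_of_chiFeasible hn' h)⟩
  refine ⟨?_, fun C _ => key C⟩
  rintro ⟨C, -, hC⟩
  obtain ⟨S, hS, hS'⟩ := key C
  exact hS' (hC S hS)
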